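/- Let $X$ be a non-empty finite set and let $a:X\to X$ be an idempotent map of rank $r=|\operatorname{im}(a)|$, with image $\{a_1,\dots,a_r\}$ (listed without repetition), and let $A_i=\{x\in X: xa=a_i\}$. Maps are written on the right and composed from left to right. Let $P$ be the semigroup of all regular elements of the variant $\mathcal T_X^a$, i.e. of all $f:X\to X$ with $f\in f\star \mathcal T_X\star f$, under $f\star g=fag$. Write $\operatorname{rank}(f)=|\operatorname{im}(f)|$, let $\mathscr L,\mathscr R,\mathscr H$ be Green's relations of $P$, and put $$\kappa=\{(f,g)\in P\times P: afa=aga\},\qquad \lambda=\kappa\cap\mathscr L,\qquad \rho=\kappa\cap\mathscr R .$$ *The congruences $R_N$.* For each $1\le q\le r$ identify the symmetric group $S_q$ with a group $\mathscr H$-class of $P$ contained in $D_q=\{f\in P:\operatorname{rank}(f)=q\}$ (such $\mathscr H$-classes exist, they are all isomorphic to $S_q$, and any identification may be used). For a normal subgroup $N$ of $S_q$ let $\nu_N=P^1(N\times N)P^1\cap(D_q\times D_q)=\{(uxv,uyv): x,y\in N,\ u,v\in P^1,\ uxv,uyv\in D_q\}$, and let $R_N^P=(I_{q-1}\times I_{q-1})\cup\nu_N\cup\Delta_P$,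 where $I_{q-1}=\{f\in P:\operatorname{rank}(f)\le q-1\}$. *$\mathcal C$-systems.* For $\emptyset\ne I\subseteq[r]=\{1,\dots,r\}$ let $\mathcal C_I$ be the set of all sets $C=\{c_i:i\in I\}$ with $c_i\in A_i$ for each $i\in I$; for $\emptyset\neq J\subseteq I$ put $C{\restriction}_J=\{c_j:j\in J\}$. A $\mathcal C$-system is a tuple $\Psi=(\psi_I)_{\emptyset\ne I\subseteq[r]}$ of equivalence relations $\psi_I$ on $\mathcal C_I$ such that $(C,C')\in\psi_I$ implies $(C{\restriction}_J,C'{\restriction}_J)\in\psi_J$ whenever $\emptyset\ne J\subseteq I$. Put $\rho(\Psi)=\bigcup_{I}\bigcup_{(C,C')\in\psi_I}\rho\cap(L_C\times L_{C'})$, where $L_C=\{f\in P:\operatorname{im}(f)=C\}$, and let $\operatorname{rank}(\Psi)$ be the largest $q\in\{0,\dots,r\}$ such that $\psi_I=\mathcal C_I\times\mathcal C_I$ whenever $|I|\le q$. *$\mathcal P$-systems.* For a partition $\mathbf I$ of $[r]$ let $\mathcal P_{\mathbf I}$ be the set of all partitions $\mathbf P=\{P_I:I\in\mathbf I\}$ of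 $X$ with $P_I\cap\operatorname{im}(a)=\{a_i:i\in I\}$ for each block $I\in\mathbf I$. If $\mathbf I$ refines a partition $\mathbf J$ of $[r]$ (written $\mathbf J\preceq\mathbf I$), let $\mathbf P{\restriction}_{\mathbf J}=\{Q_J:J\in\mathbf J\}\in\mathcal P_{\mathbf J}$ with $Q_J=\bigcup\{P_I: I\in\mathbf I,\ I\subseteq J\}$. A $\mathcal P$-system is a tuple $\Psi=(\psi_{\mathbf I})$, indexed by all partitions $\mathbf I$ of $[r]$, of equivalence relations $\psi_{\mathbf I}$ on $\mathcal P_{\mathbf I}$ such that $(\mathbf P,\mathbf P')\in\psi_{\mathbf I}$ implies $(\mathbf P{\restriction}_{\mathbf J},\mathbf P'{\restriction}_{\mathbf J})\in\psi_{\mathbf J}$ whenever $\mathbf J\preceq\mathbf I$. Put $\lambda(\Psi)=\bigcup_{\mathbf I}\bigcup_{(\mathbf P,\mathbf P')\in\psi_{\mathbf I}}\lambda\cap(R_{\mathbf P}\times R_{\mathbf P'})$, where $R_{\mathbf P}=\{f\in P: X/\ker(f)=\mathbf P\}$, and let $\operatorname{rank}(\Psi)$ be the largest $q\in\{0,\dots,r\}$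 such that $\psi_{\mathbf I}=\mathcal P_{\mathbf I}\times\mathcal P_{\mathbf I}$ whenever $|\mathbf I|\le q$. All the relations $R_N^P$, $\lambda(\Psi)$, $\rho(\Psi)$ are congruences of $P$. **Theorem.** For every congruence $\sigma\ne P\times P$ of $P$ there is a unique choice of $q$ with $1\le q\le r$, a normal subgroup $N$ of $S_q$, a $\mathcal P$-system $\Psi_1$ and a $\mathcal C$-system $\Psi_2$, both of rank at least $q-1$, such that $$\sigma=R_N^P\vee\lambda(\Psi_1)\vee\rho(\Psi_2),$$ the join being taken in the lattice of congruences of $P$; and for this choice moreover $\sigma=R_N^P\circ\lambda(\Psi_1)\circ\rho(\Psi_2)$. -/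

import Mathlib

/-! ### Semigroup preliminaries -/

/-- Green's relation `𝓛`: `x 𝓛 y` iff `S¹ x = S¹ y`, i.e. `x ∈ S¹ y` and `y ∈ S¹ x`.
The monoid `S¹` is taken to be `WithOne S`; adjoining a further identity to a semigroup that
already has one does not change the relation. -/
def GreenL {S : Type*} [Semigroup S] (x y : S) : Prop :=
  (∃ u : WithOne S, (x : WithOne S) = u * y) ∧ (∃ u : WithOne S, (y : WithOne S) = u * x)

/-- Green's relation `𝓡`: `x 𝓡 y` iff `x S¹ = y S¹`. -/
def GreenR {S : Type*} [Semigroup S] (x y : S) : Prop :=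
  (∃ u : WithOne S, (x : WithOne S) = y * u) ∧ (∃ u : WithOne S, (y : WithOne S) = x * u)

/-- Green's relation `𝓗 = 𝓛 ∩ 𝓡`. -/
def GreenH {S : Type*} [Semigroup S] (x y : S) : Prop := GreenL x y ∧ GreenR x y

theorem GreenL.refl {S : Type*} [Semigroup S] (x : S) : GreenL x x :=
  ⟨⟨1, (one_mul _).symm⟩, ⟨1, (one_mul _).symm⟩⟩

theorem GreenL.symm {S : Type*} [Semigroup S] {x y : S} (h : GreenL x y) : GreenL y x :=
  ⟨h.2, h.1⟩

theorem GreenL.trans {S : Type*} [Semigroup S] {x y z : S} (h : GreenL x y) (k : GreenL y z) :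
    GreenL x z := by
  obtain ⟨⟨u, hu⟩, ⟨u', hu'⟩⟩ := h
  obtain ⟨⟨v, hv⟩, ⟨v', hv'⟩⟩ := k
  exact ⟨⟨u * v, by rw [hu, hv, mul_assoc]⟩, ⟨v' * u', by rw [hv', hu', mul_assoc]⟩⟩

theorem GreenR.refl {S : Type*} [Semigroup S] (x : S) : GreenR x x :=
  ⟨⟨1, (mul_one _).symm⟩, ⟨1, (mul_one _).symm⟩⟩

theorem GreenR.symm {S : Type*} [Semigroup S] {x y : S} (h : GreenR x y) : GreenR y x :=
  ⟨h.2, h.1⟩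

theorem GreenR.trans {S : Type*} [Semigroup S] {x y z : S} (h : GreenR x y) (k : GreenR y z) :
    GreenR x z := by
  obtain ⟨⟨u, hu⟩, ⟨u', hu'⟩⟩ := h
  obtain ⟨⟨v, hv⟩, ⟨v', hv'⟩⟩ := k
  exact ⟨⟨v * u, by rw [hu, hv, mul_assoc]⟩, ⟨u' * v', by rw [hv', hu', mul_assoc]⟩⟩

theorem GreenL.mul_right {S : Type*} [Semigroup S] {x y : S} (h : GreenL x y) (b : S) :
    GreenL (x * b) (y * b) := by
  obtain ⟨⟨u, hu⟩, ⟨u', hu'⟩⟩ := h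
  exact ⟨⟨u, by rw [WithOne.coe_mul, WithOne.coe_mul, hu, mul_assoc]⟩,
    ⟨u', by rw [WithOne.coe_mul, WithOne.coe_mul, hu', mul_assoc]⟩⟩

theorem GreenR.mul_left {S : Type*} [Semigroup S] {x y : S} (h : GreenR x y) (b : S) :
    GreenR (b * x) (b * y) := by
  obtain ⟨⟨u, hu⟩, ⟨u', hu'⟩⟩ := h
  exact ⟨⟨u, by rw [WithOne.coe_mul, WithOne.coe_mul, hu, mul_assoc]⟩,
    ⟨u', by rw [WithOne.coe_mul, WithOne.coe_mul, hu', mul_assoc]⟩⟩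

/-! ### The variant `T_X^a` and its regular part -/

/-- The underlying set of the variant `T_X^a` of the full transformation semigroup. -/
def Variant {X : Type*} (_a : X → X) : Type _ := X → X

/-- The sandwich operation `f ⋆ g = f a g`. Transformations act on the right of their arguments,
so `f a g` is `f` first, then `a`, then `g`. -/
instance Variant.instSemigroup {X : Type*} (a : X → X) : Semigroup (Variant a) where
  mul f g := fun x => g (a (f x))
  mul_assoc _ _ _ := rfl

theorem exists_regular_inverse {X : Type*} (w : X → X) : ∃ z : X → X, ∀ x, w (z (w x)) = w x := by
  classical
  refine ⟨fun y => if h : ∃ x, w x = y then h.choose else y, fun x => ?_⟩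
  have h : ∃ y, w y = w x := ⟨x, rfl⟩
  simp only [dif_pos h]
  exact h.choose_spec

/-- `Reg(T_X^a)`: the subsemigroup of all regular elements of the variant, i.e. of all `f` with
`f ∈ f ⋆ T_X^a ⋆ f`. -/
def regPart {X : Type*} (a : X → X) : Subsemigroup (Variant a) where
  carrier := {f | ∃ s : Variant a, f = f * s * f}
  mul_mem' := by
    rintro f g ⟨s, hs⟩ ⟨t, ht⟩
    obtain ⟨z, hz⟩ := exists_regular_inverse (fun x => a (g (a (f (a x)))))
    refine ⟨z, ?_⟩
    have hs' : ∀ x, f (a (s (a (f x)))) = f x := fun x => (congrFun hs x).symm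
    have ht' : ∀ x, g (a (t (a (g x)))) = g x := fun x => (congrFun ht x).symm
    funext x
    change g (a (f x)) = g (a (f (a (z (a (g (a (f x))))))))
    have h := hz (s (a (f x)))
    simp only [hs'] at h
    have h2 := congrArg (fun y => g (a (t y))) h
    simp only [ht'] at h2
    exact h2.symm

/-- The semigroup `P = Reg(T_X^a)`. -/
abbrev RegVariant {X : Type*} (a : X → X) : Type _ := ↥(regPart a)

namespace RegVariant

/-- An element of `P` as a transformation of `X`. -/
def fn {X : Type*} {a : X → X} (f : RegVariant a) : X → X := f.1

/-- The image of `f`. -/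
def im {X : Type*} {a : X → X} (f : RegVariant a) : Set X := Set.range f.fn

/-- The kernel of `f`; as a partition of `X` this is `X / ker f`. -/
def ker {X : Type*} {a : X → X} (f : RegVariant a) : Setoid X := Setoid.ker f.fn

/-- The rank of `f`, i.e. the size of its image. -/
noncomputable def rank {X : Type*} {a : X → X} (f : RegVariant a) : ℕ := f.im.ncard

/-- `φ f = a f a`. -/
def bar {X : Type*} {a : X → X} (f : RegVariant a) : X → X := fun x => a (f.fn (a x))

/-- `κ = ker φ`. -/
def kappa {X : Type*} {a : X → X} (f g : RegVariant a) : Prop := f.bar = g.bar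

/-- `λ = κ ∩ 𝓛`. -/
def lam {X : Type*} {a : X → X} (f g : RegVariant a) : Prop := kappa f g ∧ GreenL f g

/-- `ρ = κ ∩ 𝓡`. -/
def rho {X : Type*} {a : X → X} (f g : RegVariant a) : Prop := kappa f g ∧ GreenR f g

@[ext] theorem ext {X : Type*} {a : X → X} {f g : RegVariant a} (h : ∀ x, f.fn x = g.fn x) :
    f = g := Subtype.ext (funext h)

@[simp] theorem mul_fn {X : Type*} {a : X → X} (f g : RegVariant a) (x : X) :
    (f * g).fn x = g.fn (a (f.fn x)) := rfl

theorem regular {X : Type*} {a : X → X} (f : RegVariant a) :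
    ∃ s : RegVariant a, f * s * f = f := by
  obtain ⟨s, hs⟩ := f.2
  have hs' : ∀ x, f.fn (a (s (a (f.fn x)))) = f.fn x := fun x => (congrFun hs x).symm
  refine ⟨⟨s * f.1 * s, f.1, ?_⟩, ?_⟩
  · funext x
    change s (a (f.fn (a (s x)))) = s (a (f.fn (a (s (a (f.fn (a (s (a (f.fn (a (s x))))))))))))
    rw [hs', hs']
  · ext x
    change f.fn (a (s (a (f.fn (a (s (a (f.fn x)))))))) = f.fn x
    rw [hs', hs']

/-- `a` is injective on the image of each element of `P`. -/
theorem injOn {X : Type*} {a : X → X} (f : RegVariant a) {x y : X}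
    (h : a (f.fn x) = a (f.fn y)) : f.fn x = f.fn y := by
  obtain ⟨s, hs⟩ := f.regular
  have hs' : ∀ x, f.fn (a (s.fn (a (f.fn x)))) = f.fn x := fun x => by
    conv_rhs => rw [← hs]
    rfl
  rw [← hs' x, ← hs' y, h]

/-- `ker f` has a transversal in the image of `a`. -/
theorem exists_rep {X : Type*} {a : X → X} (f : RegVariant a) (x : X) :
    ∃ y ∈ Set.range a, f.fn y = f.fn x := by
  obtain ⟨s, hs⟩ := f.regular
  refine ⟨_, ⟨s.fn (a (f.fn x)), rfl⟩, ?_⟩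
  conv_rhs => rw [← hs]
  rfl

theorem lam_mul_left {X : Type*} {a : X → X} {f g : RegVariant a} (h : lam f g)
    (b : RegVariant a) : b * f = b * g := by
  obtain ⟨hk, -, u, hu⟩ := h
  obtain ⟨s, hs⟩ := f.regular
  have hg : g * (s * f) = g := by
    apply WithOne.coe_injective
    rw [WithOne.coe_mul, hu, mul_assoc, ← WithOne.coe_mul, ← mul_assoc, hs]
  have hf : f * (s * f) = f := by rw [← mul_assoc, hs]
  ext x
  have h1 : f.fn (a (b.fn x)) = (s * f).fn (f.bar (b.fn x)) := by
    conv_lhs => rw [← hf]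
    rfl
  have h2 : g.fn (a (b.fn x)) = (s * f).fn (g.bar (b.fn x)) := by
    conv_lhs => rw [← hg]
    rfl
  rw [mul_fn, mul_fn, h1, h2, hk]

theorem rho_mul_right {X : Type*} {a : X → X} {f g : RegVariant a} (h : rho f g)
    (b : RegVariant a) : f * b = g * b := by
  obtain ⟨hk, -, u, hu⟩ := h
  obtain ⟨s, hs⟩ := f.regular
  have hg : f * s * g = g := by
    apply WithOne.coe_injective
    rw [WithOne.coe_mul, hu, ← mul_assoc, ← WithOne.coe_mul, hs]
  ext x
  have h1 : a (f.fn x) = f.bar ((f * s).fn x) := by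
    conv_lhs => rw [← hs]
    rfl
  have h2 : a (g.fn x) = g.bar ((f * s).fn x) := by
    conv_lhs => rw [← hg]
    rfl
  rw [mul_fn, mul_fn, h1, h2, hk]

theorem kappa_mul_left {X : Type*} {a : X → X} {f g : RegVariant a} (h : kappa f g)
    (b : RegVariant a) : kappa (b * f) (b * g) := by
  funext x
  exact congrFun h (b.fn (a x))

theorem kappa_mul_right {X : Type*} {a : X → X} {f g : RegVariant a} (h : kappa f g)
    (b : RegVariant a) : kappa (f * b) (g * b) := by
  funext x
  exact congrArg (fun y => a (b.fn y)) (congrFun h x)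

theorem im_subset_of_eq_mul {X : Type*} {a : X → X} {f g : RegVariant a} {u : WithOne (RegVariant a)}
    (h : (g : WithOne (RegVariant a)) = u * f) : g.im ⊆ f.im := by
  induction u using WithOne.recOneCoe with
  | one =>
    rw [one_mul] at h
    rw [WithOne.coe_injective h]
  | coe u =>
    rw [← WithOne.coe_mul] at h
    rw [WithOne.coe_injective h]
    rintro _ ⟨x, rfl⟩
    exact ⟨_, rfl⟩

theorem exists_eq_of_eq_mul {X : Type*} {a : X → X} {f g : RegVariant a}
    {u : WithOne (RegVariant a)} (h : (g : WithOne (RegVariant a)) = f * u) :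
    ∃ k : X → X, ∀ x, g.fn x = k (f.fn x) := by
  induction u using WithOne.recOneCoe with
  | one =>
    rw [mul_one] at h
    rw [WithOne.coe_injective h]
    exact ⟨id, fun _ => rfl⟩
  | coe u =>
    rw [← WithOne.coe_mul] at h
    rw [WithOne.coe_injective h]
    exact ⟨fun y => u.fn (a y), fun _ => rfl⟩

theorem exists_coe_eq_mul {X : Type*} {a : X → X} (u : WithOne (RegVariant a)) (f : RegVariant a) :
    ∃ g : RegVariant a, (g : WithOne (RegVariant a)) = u * f := by
  induction u using WithOne.recOneCoe with
  | one => exact ⟨f, (one_mul _).symm⟩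
  | coe u => exact ⟨u * f, rfl⟩

theorem exists_coe_eq_mul' {X : Type*} {a : X → X} (u : WithOne (RegVariant a))
    (f : RegVariant a) : ∃ g : RegVariant a, (g : WithOne (RegVariant a)) = f * u := by
  induction u using WithOne.recOneCoe with
  | one => exact ⟨f, (mul_one _).symm⟩
  | coe u => exact ⟨f * u, rfl⟩

theorem rank_le_left {X : Type*} [Finite X] {a : X → X} {f g : RegVariant a}
    {u : WithOne (RegVariant a)} (h : (g : WithOne (RegVariant a)) = u * f) : g.rank ≤ f.rank :=
  Set.ncard_le_ncard (im_subset_of_eq_mul h) (Set.toFinite _)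

theorem rank_le_right {X : Type*} [Finite X] {a : X → X} {f g : RegVariant a}
    {u : WithOne (RegVariant a)} (h : (g : WithOne (RegVariant a)) = f * u) :
    g.rank ≤ f.rank := by
  obtain ⟨k, hk⟩ := exists_eq_of_eq_mul h
  have : g.im = k '' f.im := by
    rw [im, im, ← Set.range_comp]
    exact congrArg Set.range (funext hk)
  rw [rank, this]
  exact Set.ncard_image_le (Set.toFinite _)

theorem rank_le {X : Type*} [Finite X] {a : X → X} {f g : RegVariant a}
    {u v : WithOne (RegVariant a)} (h : (g : WithOne (RegVariant a)) = u * f * v) :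
    g.rank ≤ f.rank := by
  obtain ⟨k, hk⟩ := exists_coe_eq_mul u f
  rw [← hk] at h
  exact (rank_le_right h).trans (rank_le_left hk)

/-- Stability: `e` is a left multiple of each left multiple of `e` of the same rank. -/
theorem stable_left {X : Type*} [Finite X] {a : X → X} {e g : RegVariant a}
    {u : WithOne (RegVariant a)} (h : (g : WithOne (RegVariant a)) = u * e)
    (hr : e.rank ≤ g.rank) : ∃ p : RegVariant a, p * g = e := by
  have him : g.im = e.im :=
    Set.eq_of_subset_of_ncard_le (im_subset_of_eq_mul h) hr (Set.toFinite _)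
  obtain ⟨s, hs⟩ := g.regular
  refine ⟨e * s, ?_⟩
  ext x
  have hx : e.fn x ∈ g.im := him ▸ ⟨x, rfl⟩
  obtain ⟨y, hy⟩ := hx
  change g.fn (a (s.fn (a (e.fn x)))) = e.fn x
  rw [← hy]
  conv_rhs => rw [← hs]
  rfl

theorem stable_right {X : Type*} [Finite X] {a : X → X} {e g : RegVariant a}
    {u : WithOne (RegVariant a)} (h : (g : WithOne (RegVariant a)) = e * u)
    (hr : e.rank ≤ g.rank) : ∃ w : RegVariant a, g * w = e := by
  obtain ⟨k, hk⟩ := exists_eq_of_eq_mul h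
  have him : g.im = k '' e.im := by
    rw [im, im, ← Set.range_comp]
    exact congrArg Set.range (funext hk)
  have hinj : Set.InjOn k e.im := by
    apply Set.injOn_of_ncard_image_eq _ (Set.toFinite _)
    rw [← him]
    exact le_antisymm (rank_le_right h) hr
  obtain ⟨s, hs⟩ := g.regular
  refine ⟨s * e, ?_⟩
  ext x
  change e.fn (a (s.fn (a (g.fn x)))) = e.fn x
  apply hinj ⟨_, rfl⟩ ⟨_, rfl⟩
  rw [← hk, ← hk]
  conv_rhs => rw [← hs]
  rfl

end RegVariant

/-! ### Idempotent sandwich elements -/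

/-- An idempotent transformation `a = (A₁ ⋯ A_r; a₁ ⋯ a_r)` of rank `r` of `X`, together with the
listing `a₁, …, a_r` (without repetition) of its image. -/
structure IdempotentMap (X : Type*) (r : ℕ) where
  /-- the transformation `a` -/
  a : X → X
  idem : ∀ x, a (a x) = a x
  /-- the points `a_i` -/
  pt : Fin r → X
  pt_injective : Function.Injective pt
  range_pt : Set.range pt = Set.range a

namespace IdempotentMap

/-- The `ker(a)`-class `A_i`, the preimage of `a_i`. -/
def block {X : Type*} {r : ℕ} (A : IdempotentMap X r) (i : Fin r) : Set X := {x | A.a x = A.pt i}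

/-- The semigroup `P = Reg(T_X^a)`. -/
abbrev P {X : Type*} {r : ℕ} (A : IdempotentMap X r) : Type _ := RegVariant A.a

theorem exists_block {X : Type*} {r : ℕ} (A : IdempotentMap X r) (x : X) :
    ∃ i, x ∈ A.block i := by
  have : A.a x ∈ Set.range A.pt := A.range_pt ▸ ⟨x, rfl⟩
  obtain ⟨i, hi⟩ := this
  exact ⟨i, hi.symm⟩

theorem a_pt {X : Type*} {r : ℕ} (A : IdempotentMap X r) (i : Fin r) :
    A.a (A.pt i) = A.pt i := by
  have : A.pt i ∈ Set.range A.a := A.range_pt ▸ ⟨i, rfl⟩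
  obtain ⟨y, hy⟩ := this
  rw [← hy, A.idem]

/-! ### Cross-sections and `𝒞`-systems -/

/-- `𝒞_I`: the set of all cross-sections `{c_i : i ∈ I}`, with each `c_i ∈ A_i`. -/
def CrossSection {X : Type*} {r : ℕ} (A : IdempotentMap X r) (I : Finset (Fin r)) : Type _ :=
  {C : Set X // ∃ c : Fin r → X, (∀ i ∈ I, c i ∈ A.block i) ∧ C = c '' I}

/-- For `J ⊆ I` and `C = {c_i : i ∈ I}` in `𝒞_I`, the cross-section `C↾J = {c_j : j ∈ J}` in `𝒞_J`;
it consists of the elements of `C` that lie in some `A_j` with `j ∈ J`. -/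
def CrossSection.restrict {X : Type*} {r : ℕ} {A : IdempotentMap X r} {I J : Finset (Fin r)}
    (h : J ⊆ I) (C : A.CrossSection I) : A.CrossSection J :=
  ⟨{x ∈ C.1 | ∃ j ∈ J, x ∈ A.block j}, by
    obtain ⟨c, hc, hC⟩ := C.2
    refine ⟨c, fun j hj => hc j (h hj), ?_⟩
    rw [hC]
    ext x
    constructor
    · rintro ⟨⟨i, hi, rfl⟩, j, hj, hx⟩
      have : i = j := A.pt_injective ((hc i hi).symm.trans hx)
      exact ⟨i, this ▸ hj, rfl⟩
    · rintro ⟨j, hj, rfl⟩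
      exact ⟨⟨j, h hj, rfl⟩, j, hj, hc j (h hj)⟩⟩

/-- A `𝒞`-system: a tuple `(ψ_I)` of equivalences on the sets `𝒞_I`, for `∅ ≠ I ⊆ [r]`, such that
`ψ_I↾J ⊆ ψ_J` for all `∅ ≠ J ⊆ I ⊆ [r]`. -/
@[ext] structure CSystem {X : Type*} {r : ℕ} (A : IdempotentMap X r) where
  /-- the equivalences `ψ_I` -/
  rel : ∀ I : Finset (Fin r), I.Nonempty → Setoid (A.CrossSection I)
  restrict_rel : ∀ (I J : Finset (Fin r)) (hI : I.Nonempty) (hJ : J.Nonempty) (h : J ⊆ I)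
    (C C' : A.CrossSection I), rel I hI C C' → rel J hJ (C.restrict h) (C'.restrict h)

/-- The rank of a `𝒞`-system: the largest `q` (in `{0, …, r}`) such that `ψ_I` is the universal
relation whenever `|I| ≤ q`. -/
noncomputable def CSystem.rank {X : Type*} {r : ℕ} {A : IdempotentMap X r} (Ψ : A.CSystem) : ℕ :=
  sSup {q : ℕ | q ≤ r ∧ ∀ (I : Finset (Fin r)) (hI : I.Nonempty), I.card ≤ q → Ψ.rel I hI = ⊤}

/-- The relation `ρ(Ψ)`: the union over all `I` and all `(C, C') ∈ ψ_I` of `ρ ∩ (L_C × L_{C'})`,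
where `L_C = {f ∈ P : im f = C}`. -/
def CSystem.rhoRel {X : Type*} {r : ℕ} {A : IdempotentMap X r} (Ψ : A.CSystem) (f g : A.P) :
    Prop :=
  ∃ (I : Finset (Fin r)) (hI : I.Nonempty) (C C' : A.CrossSection I),
    Ψ.rel I hI C C' ∧ RegVariant.rho f g ∧ f.im = C.1 ∧ g.im = C'.1

theorem exists_crossSection {X : Type*} [Nonempty X] {r : ℕ} (A : IdempotentMap X r) (f : A.P) :
    ∃ (I : Finset (Fin r)) (_ : I.Nonempty) (C : A.CrossSection I), f.im = C.1 := by
  classical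
  have key : ∀ i, ∃ c, (∃ y ∈ f.im, y ∈ A.block i) → c ∈ f.im ∧ c ∈ A.block i := by
    intro i
    by_cases h : ∃ y ∈ f.im, y ∈ A.block i
    · obtain ⟨y, h1, h2⟩ := h
      exact ⟨y, fun _ => ⟨h1, h2⟩⟩
    · exact ⟨Classical.arbitrary X, fun h' => absurd h' h⟩
  choose c hc using key
  let I : Finset (Fin r) := Finset.univ.filter fun i => ∃ y ∈ f.im, y ∈ A.block i
  have hI : ∀ i, i ∈ I ↔ ∃ y ∈ f.im, y ∈ A.block i := fun i => by simp [I]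
  have hne : I.Nonempty := by
    obtain ⟨x⟩ := ‹Nonempty X›
    obtain ⟨i, hi⟩ := A.exists_block (f.fn x)
    exact ⟨i, (hI i).2 ⟨_, ⟨x, rfl⟩, hi⟩⟩
  refine ⟨I, hne, ⟨f.im, c, fun i hi => (hc i ((hI i).1 hi)).2, ?_⟩, rfl⟩
  ext y
  constructor
  · intro hy
    obtain ⟨i, hi⟩ := A.exists_block y
    have hi' : ∃ y ∈ f.im, y ∈ A.block i := ⟨y, hy, hi⟩
    refine ⟨i, (hI i).2 hi', ?_⟩
    obtain ⟨⟨u, hu⟩, h2⟩ := hc i hi'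
    obtain ⟨v, hv⟩ := hy
    rw [← hu, ← hv]
    apply f.injOn
    rw [hu, hv]
    exact h2.trans hi.symm
  · rintro ⟨i, hi, rfl⟩
    exact (hc i ((hI i).1 hi)).1

theorem CrossSection.mem_iff {X : Type*} {r : ℕ} {A : IdempotentMap X r} {I : Finset (Fin r)}
    (C : A.CrossSection I) (i : Fin r) : i ∈ I ↔ ∃ y ∈ C.1, y ∈ A.block i := by
  obtain ⟨c, hc, hC⟩ := C.2
  rw [hC]
  constructor
  · intro hi
    exact ⟨c i, ⟨i, hi, rfl⟩, hc i hi⟩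
  · rintro ⟨y, ⟨j, hj, rfl⟩, hy⟩
    have : j = i := A.pt_injective ((hc j hj).symm.trans hy)
    exact this ▸ hj

theorem CrossSection.index_eq {X : Type*} {r : ℕ} {A : IdempotentMap X r} {I J : Finset (Fin r)}
    (C : A.CrossSection I) (D : A.CrossSection J) (h : C.1 = D.1) : I = J := by
  ext i
  rw [C.mem_iff, D.mem_iff, h]

/-- If `im f = C` and the image of `b ⋆ f` is a cross-section for `J`, it is `C↾J`. -/
theorem im_mul_eq_restrict {X : Type*} {r : ℕ} {A : IdempotentMap X r} {I J : Finset (Fin r)}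
    (f b : A.P) (C : A.CrossSection I) (hC : f.im = C.1)
    (hJ : ∀ j, j ∈ J ↔ ∃ y ∈ (b * f).im, y ∈ A.block j) (h : J ⊆ I) :
    (b * f).im = (C.restrict h).1 := by
  ext y
  constructor
  · rintro ⟨x, rfl⟩
    obtain ⟨j, hj⟩ := A.exists_block ((b * f).fn x)
    exact ⟨hC ▸ ⟨_, rfl⟩, j, (hJ j).2 ⟨_, ⟨x, rfl⟩, hj⟩, hj⟩
  · rintro ⟨hy, j, hj, hyj⟩
    obtain ⟨z, ⟨x, rfl⟩, hz⟩ := (hJ j).1 hj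
    rw [← hC] at hy
    obtain ⟨u, rfl⟩ := hy
    refine ⟨x, ?_⟩
    exact f.injOn (hz.trans hyj.symm)

/-- The congruence `ρ(Ψ)` of `P`. -/
def CSystem.rhoCon {X : Type*} [Nonempty X] {r : ℕ} {A : IdempotentMap X r} (Ψ : A.CSystem) :
    Con A.P where
  r := Ψ.rhoRel
  iseqv := by
    refine ⟨fun f => ?_, ?_, ?_⟩
    · obtain ⟨I, hI, C, hC⟩ := A.exists_crossSection f
      exact ⟨I, hI, C, C, (Ψ.rel I hI).refl _, ⟨rfl, GreenR.refl _⟩, hC, hC⟩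
    · rintro f g ⟨I, hI, C, C', h, ⟨h1, h2⟩, h3, h4⟩
      exact ⟨I, hI, C', C, (Ψ.rel I hI).symm h, ⟨h1.symm, h2.symm⟩, h4, h3⟩
    · rintro f g k ⟨I, hI, C, C', h, ⟨h1, h2⟩, h3, h4⟩ ⟨J, hJ, D, D', h', ⟨h1', h2'⟩, h3', h4'⟩
      obtain rfl : I = J := C'.index_eq D (h4.symm.trans h3')
      obtain rfl : C' = D := Subtype.ext (h4.symm.trans h3')
      exact ⟨I, hI, C, D', (Ψ.rel I hI).trans h h', ⟨h1.trans h1', h2.trans h2'⟩, h3, h4'⟩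
  mul' := by
    rintro b b' f g ⟨_, _, _, _, _, hb, _, _⟩ ⟨I, hI, C, C', h, ⟨h1, h2⟩, h3, h4⟩
    rw [RegVariant.rho_mul_right hb f]
    obtain ⟨J, hJ, D, hD⟩ := A.exists_crossSection (b' * f)
    have hJ1 : ∀ j, j ∈ J ↔ ∃ y ∈ (b' * f).im, y ∈ A.block j := fun j => by
      rw [D.mem_iff, hD]
    have hsw : ∀ x, A.a ((b' * f).fn x) = A.a ((b' * g).fn x) := fun x =>
      congrFun h1 (b'.fn x)
    have hJ2 : ∀ j, j ∈ J ↔ ∃ y ∈ (b' * g).im, y ∈ A.block j := by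
      intro j
      rw [hJ1]
      constructor
      · rintro ⟨_, ⟨x, rfl⟩, hx⟩
        exact ⟨_, ⟨x, rfl⟩, (hsw x).symm.trans hx⟩
      · rintro ⟨_, ⟨x, rfl⟩, hx⟩
        exact ⟨_, ⟨x, rfl⟩, (hsw x).trans hx⟩
    have hJI : J ⊆ I := by
      intro j hj
      obtain ⟨_, ⟨x, rfl⟩, hx⟩ := (hJ1 j).1 hj
      exact (C.mem_iff j).2 ⟨_, h3 ▸ ⟨_, rfl⟩, hx⟩
    exact ⟨J, hJ, C.restrict hJI, C'.restrict hJI, Ψ.restrict_rel I J hI hJ hJI C C' h,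
      ⟨RegVariant.kappa_mul_left h1 b', h2.mul_left b'⟩,
      im_mul_eq_restrict f b' C h3 hJ1 hJI, im_mul_eq_restrict g b' C' h4 hJ2 hJI⟩

/-! ### Partitions and `𝒫`-systems -/

/-- `𝒫_𝐈` for a partition `𝐈` of `[r]`: the set of all partitions `𝐏 = {P_I : I ∈ 𝐈}` of `X` with
`P_I ∩ im(a) = {a_i : i ∈ I}` for each `I ∈ 𝐈`. Partitions are given by their equivalence relations:
the condition says that every block of `𝐏` contains some `a_i`, and that `a_i` and `a_j` lie in the
same block of `𝐏` iff `i` and `j` lie in the same block of `𝐈`. -/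
def PartitionOver {X : Type*} {r : ℕ} (A : IdempotentMap X r) (I : Setoid (Fin r)) : Type _ :=
  {S : Setoid X // (∀ x, ∃ i, S x (A.pt i)) ∧ ∀ i j, S (A.pt i) (A.pt j) ↔ I i j}

/-- For `𝐉 ⪯ 𝐈` (i.e. `𝐈` refines `𝐉`) and `𝐏` in `𝒫_𝐈`, the partition `𝐏↾𝐉` in `𝒫_𝐉`, whose blocks are
the unions `Q_J` of all `P_I` with `I ⊆ J`, for `J ∈ 𝐉`: two points are in the same block of `𝐏↾𝐉` iff
the blocks `P_I`, `P_{I'}` of `𝐏` containing them have `I`, `I'` in the same block of `𝐉`. -/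
def PartitionOver.restrict {X : Type*} {r : ℕ} {A : IdempotentMap X r} {I J : Setoid (Fin r)}
    (h : I ≤ J) (S : A.PartitionOver I) : A.PartitionOver J :=
  ⟨{ r := fun x y => ∃ i j, S.1 x (A.pt i) ∧ S.1 y (A.pt j) ∧ J i j
     iseqv := by
      refine ⟨fun x => ?_, ?_, ?_⟩
      · obtain ⟨i, hi⟩ := S.2.1 x
        exact ⟨i, i, hi, hi, J.refl i⟩
      · rintro x y ⟨i, j, h1, h2, h3⟩
        exact ⟨j, i, h2, h1, J.symm h3⟩
      · rintro x y z ⟨i, j, h1, h2, h3⟩ ⟨k, l, h4, h5, h6⟩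
        have h7 : I j k := (S.2.2 j k).1 (S.1.trans (S.1.symm h2) h4)
        exact ⟨i, l, h1, h5, J.trans h3 (J.trans (h h7) h6)⟩ }, by
    refine ⟨fun x => ?_, fun i j => ⟨?_, ?_⟩⟩
    · obtain ⟨i, hi⟩ := S.2.1 x
      exact ⟨i, i, i, hi, S.1.refl _, J.refl i⟩
    · rintro ⟨k, l, h1, h2, h3⟩
      have h4 : J i k := h ((S.2.2 i k).1 h1)
      have h5 : J j l := h ((S.2.2 j l).1 h2)
      exact J.trans h4 (J.trans h3 (J.symm h5))
    · intro hij
      exact ⟨i, j, S.1.refl _, S.1.refl _, hij⟩⟩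

/-- A `𝒫`-system: a tuple `(ψ_𝐈)` of equivalences on the sets `𝒫_𝐈`, for the partitions `𝐈` of `[r]`,
such that `ψ_𝐈↾𝐉 ⊆ ψ_𝐉` whenever `𝐈` refines `𝐉`. -/
@[ext] structure PSystem {X : Type*} {r : ℕ} (A : IdempotentMap X r) where
  /-- the equivalences `ψ_𝐈` -/
  rel : ∀ I : Setoid (Fin r), Setoid (A.PartitionOver I)
  restrict_rel : ∀ (I J : Setoid (Fin r)) (h : I ≤ J) (S S' : A.PartitionOver I),
    rel I S S' → rel J (S.restrict h) (S'.restrict h)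

/-- The rank of a `𝒫`-system: the largest `q` (in `{0, …, r}`) such that `ψ_𝐈` is the universal
relation whenever `𝐈` has at most `q` blocks. -/
noncomputable def PSystem.rank {X : Type*} {r : ℕ} {A : IdempotentMap X r} (Ψ : A.PSystem) : ℕ :=
  sSup {q : ℕ | q ≤ r ∧ ∀ I : Setoid (Fin r), Nat.card (Quotient I) ≤ q → Ψ.rel I = ⊤}

/-- The relation `λ(Ψ)`: the union over all `𝐈` and all `(𝐏, 𝐏') ∈ ψ_𝐈` of `λ ∩ (R_𝐏 × R_{𝐏'})`,
where `R_𝐏 = {f ∈ P : X / ker f = 𝐏}`. -/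
def PSystem.lamRel {X : Type*} {r : ℕ} {A : IdempotentMap X r} (Ψ : A.PSystem) (f g : A.P) :
    Prop :=
  ∃ (I : Setoid (Fin r)) (S S' : A.PartitionOver I),
    Ψ.rel I S S' ∧ RegVariant.lam f g ∧ f.ker = S.1 ∧ g.ker = S'.1

theorem exists_partitionOver {X : Type*} {r : ℕ} (A : IdempotentMap X r) (f : A.P) :
    ∃ (I : Setoid (Fin r)) (S : A.PartitionOver I), f.ker = S.1 := by
  refine ⟨Setoid.ker (fun i => f.fn (A.pt i)), ⟨f.ker, fun x => ?_, fun i j => Iff.rfl⟩, rfl⟩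
  obtain ⟨y, hy, h⟩ := f.exists_rep x
  rw [← A.range_pt] at hy
  obtain ⟨i, rfl⟩ := hy
  exact ⟨i, h.symm⟩

theorem PartitionOver.index_eq {X : Type*} {r : ℕ} {A : IdempotentMap X r} {I J : Setoid (Fin r)}
    (S : A.PartitionOver I) (T : A.PartitionOver J) (h : S.1 = T.1) : I = J := by
  ext i j
  rw [← S.2.2, ← T.2.2, h]

/-- If `X / ker f = 𝐏` and the kernel of `f ⋆ b` lies over `𝐉`, it is `𝐏↾𝐉`. -/
theorem ker_mul_eq_restrict {X : Type*} {r : ℕ} {A : IdempotentMap X r} {I J : Setoid (Fin r)}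
    (f b : A.P) (S : A.PartitionOver I) (hS : f.ker = S.1)
    (hJ : ∀ i j, J i j ↔ (f * b).fn (A.pt i) = (f * b).fn (A.pt j)) (h : I ≤ J) :
    (f * b).ker = (S.restrict h).1 := by
  have hS' : ∀ x y, S.1 x y ↔ f.fn x = f.fn y := fun x y => by rw [← hS]; exact Iff.rfl
  ext x y
  constructor
  · intro hxy
    obtain ⟨i, hi⟩ := S.2.1 x
    obtain ⟨j, hj⟩ := S.2.1 y
    refine ⟨i, j, hi, hj, (hJ i j).2 ?_⟩
    rw [RegVariant.mul_fn, RegVariant.mul_fn, ← (hS' _ _).1 hi, ← (hS' _ _).1 hj]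
    exact hxy
  · rintro ⟨i, j, hi, hj, hij⟩
    have := (hJ i j).1 hij
    rw [RegVariant.mul_fn, RegVariant.mul_fn, ← (hS' _ _).1 hi, ← (hS' _ _).1 hj] at this
    exact this

/-- The congruence `λ(Ψ)` of `P`. -/
def PSystem.lamCon {X : Type*} {r : ℕ} {A : IdempotentMap X r} (Ψ : A.PSystem) : Con A.P where
  r := Ψ.lamRel
  iseqv := by
    refine ⟨fun f => ?_, ?_, ?_⟩
    · obtain ⟨I, S, hS⟩ := A.exists_partitionOver f
      exact ⟨I, S, S, (Ψ.rel I).refl _, ⟨rfl, GreenL.refl _⟩, hS, hS⟩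
    · rintro f g ⟨I, C, C', h, ⟨h1, h2⟩, h3, h4⟩
      exact ⟨I, C', C, (Ψ.rel I).symm h, ⟨h1.symm, h2.symm⟩, h4, h3⟩
    · rintro f g k ⟨I, C, C', h, ⟨h1, h2⟩, h3, h4⟩ ⟨J, D, D', h', ⟨h1', h2'⟩, h3', h4'⟩
      obtain rfl : I = J := C'.index_eq D (h4.symm.trans h3')
      obtain rfl : C' = D := Subtype.ext (h4.symm.trans h3')
      exact ⟨I, C, D', (Ψ.rel I).trans h h', ⟨h1.trans h1', h2.trans h2'⟩, h3, h4'⟩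
  mul' := by
    rintro f g b b' ⟨I, S, S', h, ⟨h1, h2⟩, h3, h4⟩ ⟨_, _, _, _, hb, _, _⟩
    rw [← RegVariant.lam_mul_left hb g]
    obtain ⟨J, D, hD⟩ := A.exists_partitionOver (f * b)
    have hJ1 : ∀ i j, J i j ↔ (f * b).fn (A.pt i) = (f * b).fn (A.pt j) := fun i j => by
      rw [← D.2.2, ← hD]
      exact Iff.rfl
    have hsw : ∀ i, (f * b).fn (A.pt i) = (g * b).fn (A.pt i) := fun i => by
      have := congrFun h1 (A.pt i)
      simp only [RegVariant.bar, A.a_pt] at this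
      rw [RegVariant.mul_fn, RegVariant.mul_fn, this]
    have hJ2 : ∀ i j, J i j ↔ (g * b).fn (A.pt i) = (g * b).fn (A.pt j) := fun i j => by
      rw [hJ1, hsw, hsw]
    have hIJ : I ≤ J := by
      intro i j hij
      rw [← S.2.2, ← h3] at hij
      refine (hJ1 i j).2 ?_
      rw [RegVariant.mul_fn, RegVariant.mul_fn]
      exact congrArg (fun y => b.fn (A.a y)) hij
    exact ⟨J, S.restrict hIJ, S'.restrict hIJ, Ψ.restrict_rel I J hIJ S S' h,
      ⟨RegVariant.kappa_mul_right h1 b, h2.mul_right b⟩,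
      ker_mul_eq_restrict f b S h3 hJ1 hIJ, ker_mul_eq_restrict g b S' h4 hJ2 hIJ⟩

/-! ### The congruences `R_N` -/

/-- An identification of the symmetric group `S_q` with a group `𝓗`-class of `P` contained in
`D_q = {f ∈ P : rank f = q}`: an injective multiplicative map `S_q → P` whose image is the
`𝓗`-class of (the idempotent) `ι 1`, which has rank `q`. -/
structure SymIdentification {X : Type*} {r : ℕ} (A : IdempotentMap X r) (q : ℕ) where
  /-- the map `S_q → P` -/
  ι : Equiv.Perm (Fin q) →ₙ* A.P
  injective : Function.Injective ι
  rank_one : (ι 1).rank = q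
  mem_range_iff : ∀ f : A.P, f ∈ Set.range ι ↔ GreenH f (ι 1)

/-- Such identifications exist for all `1 ≤ q ≤ r`. -/
theorem nonempty_symIdentification {X : Type*} {r : ℕ} (A : IdempotentMap X r)
    (q : ℕ) (h1 : 1 ≤ q) (hq : q ≤ r) : Nonempty (A.SymIdentification q) := by
  classical
  let c : Fin q → X := fun i => A.pt (Fin.castLE hq i)
  have hc : Function.Injective c := A.pt_injective.comp (Fin.castLE_injective hq)
  have hb : ∃ b : X → Fin q, (∀ x, b (A.a x) = b x) ∧ ∀ i, b (c i) = i := by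
    choose k hk using A.exists_block
    refine ⟨fun x => if h : (k x).1 < q then ⟨k x, h⟩ else ⟨0, h1⟩, fun x => ?_, fun i => ?_⟩
    · have : k (A.a x) = k x := A.pt_injective (by
        rw [← hk (A.a x), ← hk x, A.idem])
      simp only [this]
    · have : k (c i) = Fin.castLE hq i := A.pt_injective (by
        rw [← hk (c i)]
        exact A.a_pt _)
      simp [this]
  obtain ⟨b, hba, hbc⟩ := hb
  let j : Equiv.Perm (Fin q) → Variant A.a := fun x z => c (x⁻¹ (b z))
  have hj : ∀ x y, j (x * y) = j x * j y := fun x y => by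
    funext z
    change c ((x * y)⁻¹ (b z)) = c (y⁻¹ (b (A.a (c (x⁻¹ (b z))))))
    rw [hba, hbc, mul_inv_rev]
    rfl
  let ι : Equiv.Perm (Fin q) →ₙ* A.P :=
    { toFun := fun x => ⟨j x, j x⁻¹, by rw [← hj, ← hj]; simp⟩
      map_mul' := fun x y => Subtype.ext (hj x y) }
  have hι : ∀ x z, (ι x).fn z = c (x⁻¹ (b z)) := fun _ _ => rfl
  have him : (ι 1).im = Set.range c := by
    ext y
    constructor
    · rintro ⟨z, rfl⟩
      exact ⟨_, rfl⟩
    · rintro ⟨i, rfl⟩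
      exact ⟨c i, by rw [hι, hbc]; rfl⟩
  refine ⟨ι, fun x y hxy => ?_, ?_, fun f => ⟨?_, ?_⟩⟩
  · apply inv_injective
    ext i
    have := congrArg (fun f : A.P => f.fn (c i)) hxy
    simp only [hι, hbc] at this
    rw [hc this]
  · rw [RegVariant.rank, him, ← Set.image_univ, Set.ncard_image_of_injective _ hc, Set.ncard_univ,
      Nat.card_eq_fintype_card, Fintype.card_fin]
  · rintro ⟨x, rfl⟩
    refine ⟨⟨⟨ι x, ?_⟩, ⟨ι x⁻¹, ?_⟩⟩, ⟨⟨ι x, ?_⟩, ⟨ι x⁻¹, ?_⟩⟩⟩ <;>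
      rw [← WithOne.coe_mul, ← map_mul] <;> simp
  · rintro ⟨⟨⟨u, hu⟩, -⟩, ⟨⟨v, hv⟩, ⟨w, hw⟩⟩⟩
    obtain ⟨k, hk⟩ := RegVariant.exists_eq_of_eq_mul hv
    obtain ⟨l, hl⟩ := RegVariant.exists_eq_of_eq_mul hw
    have hf : ∀ z, ∃ i, f.fn z = c i := fun z => by
      have : f.fn z ∈ (ι 1).im := RegVariant.im_subset_of_eq_mul hu ⟨z, rfl⟩
      rw [him] at this
      obtain ⟨i, hi⟩ := this
      exact ⟨i, hi.symm⟩
    choose p hp using hf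
    have hz : ∀ z, (ι 1).fn z = (ι 1).fn (c (b z)) := fun z => by rw [hι, hι, hbc]
    have hinj : Function.Injective fun i => p (c i) := fun i i' h => by
      have h2 : (ι 1).fn (c i) = (ι 1).fn (c i') := by
        rw [hl, hl, hp, hp]
        exact congrArg (fun i => l (c i)) h
      rw [hι, hι, hbc, hbc] at h2
      exact hc h2
    let π : Equiv.Perm (Fin q) :=
      Equiv.ofBijective _ (Finite.injective_iff_bijective.1 hinj)
    refine ⟨π⁻¹, ?_⟩
    ext z
    rw [hι, inv_inv]
    change c (p (c (b z))) = f.fn z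
    rw [← hp, hk, ← hz, ← hk]

/-- For `N ≤ S_q`, the relation `ν_N = S¹ (N × N) S¹ ∩ (D_q × D_q)` (with `S = P`), where `S_q` is
identified with a group `𝓗`-class of `P` contained in `D_q`. -/
def SymIdentification.nu {X : Type*} {r : ℕ} {A : IdempotentMap X r} {q : ℕ}
    (E : A.SymIdentification q) (N : Subgroup (Equiv.Perm (Fin q))) (f g : A.P) : Prop :=
  f.rank = q ∧ g.rank = q ∧ ∃ (u v : WithOne A.P) (x y : Equiv.Perm (Fin q)), x ∈ N ∧ y ∈ N ∧
    (f : WithOne A.P) = u * E.ι x * v ∧ (g : WithOne A.P) = u * E.ι y * v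

/-- The relation `R_N = ∇_{I_{q-1}} ∪ ν_N ∪ Δ`, where `I_{q-1} = {f ∈ P : rank f ≤ q - 1}`. -/
def SymIdentification.RRel {X : Type*} {r : ℕ} {A : IdempotentMap X r} {q : ℕ}
    (E : A.SymIdentification q) (N : Subgroup (Equiv.Perm (Fin q))) (f g : A.P) : Prop :=
  (f.rank < q ∧ g.rank < q) ∨ E.nu N f g ∨ f = g

theorem SymIdentification.coe_mul {X : Type*} {r : ℕ} {A : IdempotentMap X r} {q : ℕ}
    (E : A.SymIdentification q) (x y : Equiv.Perm (Fin q)) :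
    ((E.ι (x * y) : A.P) : WithOne A.P) = E.ι x * E.ι y := by
  rw [map_mul, WithOne.coe_mul]

theorem SymIdentification.one_mul' {X : Type*} {r : ℕ} {A : IdempotentMap X r} {q : ℕ}
    (E : A.SymIdentification q) (x : Equiv.Perm (Fin q)) :
    ((E.ι 1 : A.P) : WithOne A.P) * E.ι x = E.ι x := by
  rw [← E.coe_mul, one_mul]

theorem SymIdentification.mul_one' {X : Type*} {r : ℕ} {A : IdempotentMap X r} {q : ℕ}
    (E : A.SymIdentification q) (x : Equiv.Perm (Fin q)) :
    (E.ι x : WithOne A.P) * (E.ι 1 : A.P) = E.ι x := by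
  rw [← E.coe_mul, mul_one]

theorem SymIdentification.rank_eq {X : Type*} [Finite X] {r : ℕ} {A : IdempotentMap X r} {q : ℕ}
    (E : A.SymIdentification q) (x : Equiv.Perm (Fin q)) : (E.ι x).rank = q := by
  obtain ⟨⟨⟨u, hu⟩, ⟨v, hv⟩⟩, -⟩ := (E.mem_range_iff (E.ι x)).1 ⟨x, rfl⟩
  exact (le_antisymm (RegVariant.rank_le_left hu) (RegVariant.rank_le_left hv)).trans E.rank_one

/-- Left and right cancellation for elements `u x v` of rank `q` with `x ∈ S_q`. -/
theorem SymIdentification.cancel {X : Type*} [Finite X] {r : ℕ} {A : IdempotentMap X r} {q : ℕ}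
    (E : A.SymIdentification q) {f : A.P} (hf : f.rank = q) {u v : WithOne A.P}
    {x : Equiv.Perm (Fin q)} (h : (f : WithOne A.P) = u * E.ι x * v) :
    (∃ p : WithOne A.P, p * u * (E.ι 1 : A.P) = (E.ι 1 : A.P)) ∧
      ∃ w : WithOne A.P, (E.ι 1 : A.P) * v * w = (E.ι 1 : A.P) := by
  constructor
  · obtain ⟨g, hg⟩ := RegVariant.exists_coe_eq_mul u (E.ι 1)
    have hfg : (f : WithOne A.P) = g * (E.ι x * v) := by
      rw [hg, h, mul_assoc u (E.ι 1 : WithOne A.P), ← mul_assoc (E.ι 1 : WithOne A.P), E.one_mul',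
        mul_assoc]
    have hr := RegVariant.rank_le_right hfg
    rw [hf, ← E.rank_one] at hr
    obtain ⟨p, hp⟩ := RegVariant.stable_left hg hr
    refine ⟨p, ?_⟩
    rw [mul_assoc, ← hg, ← WithOne.coe_mul, hp]
  · obtain ⟨g, hg⟩ := RegVariant.exists_coe_eq_mul' v (E.ι 1)
    have hfg : (f : WithOne A.P) = (u * E.ι x) * g := by
      rw [hg, h, mul_assoc u, mul_assoc u, ← mul_assoc (E.ι x : WithOne A.P) (E.ι 1), E.mul_one']
    have hr := RegVariant.rank_le_left hfg
    rw [hf, ← E.rank_one] at hr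
    obtain ⟨p, hp⟩ := RegVariant.stable_right hg hr
    refine ⟨p, ?_⟩
    rw [← hg, ← WithOne.coe_mul, hp]

/-- An element of `e P e` from which `e` can be recovered by multiplication lies in `S_q`. -/
theorem SymIdentification.mem_of_rank {X : Type*} [Finite X] {r : ℕ} {A : IdempotentMap X r}
    {q : ℕ} (E : A.SymIdentification q) {s : WithOne A.P} {t : A.P}
    (hs : s = E.ι 1 * t * E.ι 1) (hr : ∃ p w : WithOne A.P, ((E.ι 1 : A.P) : WithOne A.P) = p * s * w) :
    ∃ z, s = (E.ι z : A.P) := by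
  set e : A.P := E.ι 1 with he
  have hee : (e : WithOne A.P) * e = e := E.one_mul' 1
  have hs' : s = ((e * t * e : A.P) : WithOne A.P) := by
    rw [hs, WithOne.coe_mul, WithOne.coe_mul]
  obtain ⟨p, w, hpw⟩ := hr
  rw [hs'] at hpw
  have hrank := RegVariant.rank_le hpw
  have h1 : ((e * t * e : A.P) : WithOne A.P) = ((e * t : A.P) : WithOne A.P) * e := rfl
  have h2 : ((e * t * e : A.P) : WithOne A.P) = e * ((t * e : A.P) : WithOne A.P) := by
    rw [mul_assoc]
    rfl
  obtain ⟨c, hc⟩ := RegVariant.stable_left h1 hrank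
  obtain ⟨d, hd⟩ := RegVariant.stable_right h2 hrank
  have : (e * t * e) ∈ Set.range E.ι := by
    rw [E.mem_range_iff]
    refine ⟨⟨⟨_, h1⟩, ⟨c, ?_⟩⟩, ⟨⟨_, h2⟩, ⟨d, ?_⟩⟩⟩
    · rw [← WithOne.coe_mul, hc]
    · rw [← WithOne.coe_mul, hd]
  obtain ⟨z, hz⟩ := this
  exact ⟨z, by rw [hs', hz]⟩

theorem SymIdentification.nu_trans {X : Type*} [Finite X] {r : ℕ} {A : IdempotentMap X r}
    {q : ℕ} (E : A.SymIdentification q) {N : Subgroup (Equiv.Perm (Fin q))} (hN : N.Normal)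
    {f g h : A.P} (h1 : E.nu N f g) (h2 : E.nu N g h) : E.nu N f h := by
  obtain ⟨hf, hg, u, v, x, y, hx, hy, h3, h4⟩ := h1
  obtain ⟨-, hh, u', v', x', y', hx', hy', h5, h6⟩ := h2
  obtain ⟨⟨p, hp⟩, ⟨w, hw⟩⟩ := E.cancel hg h4
  obtain ⟨⟨p', hp'⟩, ⟨w', hw'⟩⟩ := E.cancel hg h5
  have h7 : u * E.ι y * v = u' * E.ι x' * v' := h4.symm.trans h5
  have e1 := E.one_mul'
  have e2 := E.mul_one'
  have e12 : ∀ z, (E.ι z : WithOne A.P) = E.ι 1 * E.ι z * E.ι 1 := fun z => by rw [e1, e2]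
  -- `u' e = u s` with `s` in the group
  have hs : ∃ z, E.ι y * v * w' * E.ι x'⁻¹ = (E.ι z : A.P) ∧
      u' * (E.ι 1 : A.P) = u * E.ι z := by
    have hue : u' * (E.ι 1 : A.P) = u * (E.ι y * v * w' * E.ι x'⁻¹) := by
      calc u' * (E.ι 1 : A.P) = u' * (E.ι x' * E.ι x'⁻¹) := by
            rw [← E.coe_mul, mul_inv_cancel]
        _ = u' * (E.ι x' * (E.ι 1 * v' * w') * E.ι x'⁻¹) := by rw [hw', e2]
        _ = u' * (E.ι x' * E.ι 1) * v' * w' * E.ι x'⁻¹ := by simp only [mul_assoc]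
        _ = (u * E.ι y * v) * w' * E.ι x'⁻¹ := by rw [e2, h7]
        _ = _ := by simp only [mul_assoc]
    obtain ⟨k, hk⟩ := RegVariant.exists_coe_eq_mul (v * w') (E.ι x'⁻¹)
    obtain ⟨z, hz⟩ := E.mem_of_rank (s := E.ι y * v * w' * E.ι x'⁻¹) (t := E.ι y * k)
      (by
        rw [WithOne.coe_mul, hk]
        calc (E.ι y * v * w' * E.ι x'⁻¹ : WithOne A.P)
            = (E.ι 1 * E.ι y) * v * w' * (E.ι x'⁻¹ * E.ι 1) := by rw [e1, e2]
          _ = _ := by simp only [mul_assoc])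
      ⟨p' * u, 1, by rw [mul_one, mul_assoc, ← hue, ← mul_assoc, hp']⟩
    exact ⟨z, hz, by rw [hue, hz]⟩
  obtain ⟨s, -, hs⟩ := hs
  have ht : ∃ z, (E.ι 1 : A.P) * v' = (E.ι z : WithOne A.P) * v := by
    have hve : (E.ι 1 : A.P) * v' = (E.ι x'⁻¹ * p' * u * E.ι y) * v := by
      calc (E.ι 1 : A.P) * v' = (E.ι x'⁻¹ * E.ι x' : WithOne A.P) * v' := by
            rw [← E.coe_mul, inv_mul_cancel]
        _ = E.ι x'⁻¹ * (E.ι 1 * E.ι x') * v' := by rw [e1]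
        _ = E.ι x'⁻¹ * ((p' * u' * E.ι 1) * E.ι x') * v' := by rw [hp']
        _ = E.ι x'⁻¹ * p' * (u' * (E.ι 1 * E.ι x') * v') := by simp only [mul_assoc]
        _ = E.ι x'⁻¹ * p' * (u * E.ι y * v) := by rw [e1, h7]
        _ = _ := by simp only [mul_assoc]
    obtain ⟨k, hk⟩ := RegVariant.exists_coe_eq_mul' (p' * u) (E.ι x'⁻¹)
    obtain ⟨z, hz⟩ := E.mem_of_rank (s := E.ι x'⁻¹ * p' * u * E.ι y) (t := k * E.ι y)
      (by
        rw [WithOne.coe_mul, hk]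
        calc (E.ι x'⁻¹ * p' * u * E.ι y : WithOne A.P)
            = (E.ι 1 * E.ι x'⁻¹) * p' * u * (E.ι y * E.ι 1) := by rw [e1, e2]
          _ = _ := by simp only [mul_assoc])
      ⟨1, v * w', by rw [one_mul, ← mul_assoc, ← hve, hw']⟩
    exact ⟨z, by rw [hve, hz]⟩
  obtain ⟨t, ht⟩ := ht
  have key : ∀ z, u' * E.ι z * v' = u * E.ι (s * z * t) * v := fun z => by
    calc u' * E.ι z * v' = u' * (E.ι 1 * E.ι z * E.ι 1) * v' := by rw [← e12]
      _ = (u' * E.ι 1) * E.ι z * (E.ι 1 * v') := by simp only [mul_assoc]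
      _ = _ := by
        rw [hs, ht, E.coe_mul, E.coe_mul]
        simp only [mul_assoc]
  have hy2 : y = s * x' * t := by
    apply E.injective
    apply WithOne.coe_injective
    have h9 : ∀ z, (p * (u * E.ι z * v) * (w * E.ι 1) : WithOne A.P) = E.ι z := fun z => by
      calc (p * (u * E.ι z * v) * (w * E.ι 1) : WithOne A.P)
          = p * (u * (E.ι 1 * E.ι z * E.ι 1) * v) * (w * E.ι 1) := by rw [← e12]
        _ = (p * u * E.ι 1) * E.ι z * (E.ι 1 * v * w) * E.ι 1 := by simp only [mul_assoc]
        _ = _ := by rw [hp, hw, e1, e2, e2]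
    rw [← h9 y, ← h9 (s * x' * t), ← key x', h7]
  refine ⟨hf, hh, u, v, x, s * y' * t, hx, ?_, h3, ?_⟩
  · have : s * y' * t = s * (y' * x'⁻¹) * s⁻¹ * y := by
      rw [hy2]
      group
    rw [this]
    exact N.mul_mem (hN.conj_mem _ (N.mul_mem hy' (N.inv_mem hx')) s) hy
  · rw [h6, key]

theorem SymIdentification.nu_symm {X : Type*} {r : ℕ} {A : IdempotentMap X r} {q : ℕ}
    (E : A.SymIdentification q) {N : Subgroup (Equiv.Perm (Fin q))} {f g : A.P}
    (h : E.nu N f g) : E.nu N g f := by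
  obtain ⟨hf, hg, u, v, x, y, hx, hy, h1, h2⟩ := h
  exact ⟨hg, hf, u, v, y, x, hy, hx, h2, h1⟩

theorem SymIdentification.rank_of_rank {X : Type*} [Finite X] {r : ℕ} {A : IdempotentMap X r}
    {q : ℕ} (E : A.SymIdentification q) {f g : A.P} {u v : WithOne A.P}
    {x y : Equiv.Perm (Fin q)} (hf : (f : WithOne A.P) = u * E.ι x * v)
    (hg : (g : WithOne A.P) = u * E.ι y * v) (h : f.rank = q) : g.rank = q := by
  obtain ⟨⟨p, hp⟩, ⟨w, hw⟩⟩ := E.cancel h hf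
  apply le_antisymm
  · exact (RegVariant.rank_le hg).trans (E.rank_eq y).le
  · have : (E.ι y : WithOne A.P) = p * g * (w * E.ι 1) := by
      calc (E.ι y : WithOne A.P) = (p * u * E.ι 1) * E.ι y * (E.ι 1 * v * w) * E.ι 1 := by
            rw [hp, hw, E.one_mul', E.mul_one', E.mul_one']
        _ = p * u * (E.ι 1 * E.ι y * E.ι 1) * v * w * E.ι 1 := by simp only [mul_assoc]
        _ = _ := by
          rw [E.one_mul', E.mul_one', hg]
          simp only [mul_assoc]
    rw [← E.rank_eq y]
    exact RegVariant.rank_le this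

theorem SymIdentification.RRel_of_eq_mul {X : Type*} [Finite X] {r : ℕ} {A : IdempotentMap X r}
    {q : ℕ} (E : A.SymIdentification q) {N : Subgroup (Equiv.Perm (Fin q))} {f g : A.P}
    {u v : WithOne A.P} {x y : Equiv.Perm (Fin q)} (hx : x ∈ N) (hy : y ∈ N)
    (hf : (f : WithOne A.P) = u * E.ι x * v)
    (hg : (g : WithOne A.P) = u * E.ι y * v) : E.RRel N f g := by
  have hf' := (RegVariant.rank_le hf).trans (E.rank_eq x).le
  have hg' := (RegVariant.rank_le hg).trans (E.rank_eq y).le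
  by_cases h : f.rank = q
  · exact Or.inr (Or.inl ⟨h, E.rank_of_rank hf hg h, u, v, x, y, hx, hy, hf, hg⟩)
  · have h' : g.rank ≠ q := fun h' => h (E.rank_of_rank hg hf h')
    exact Or.inl ⟨lt_of_le_of_ne hf' h, lt_of_le_of_ne hg' h'⟩

theorem SymIdentification.RRel_trans {X : Type*} [Finite X] {r : ℕ} {A : IdempotentMap X r}
    {q : ℕ} (E : A.SymIdentification q) {N : Subgroup (Equiv.Perm (Fin q))} (hN : N.Normal)
    {f g h : A.P} (h1 : E.RRel N f g) (h2 : E.RRel N g h) : E.RRel N f h := by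
  rcases h1 with ⟨h1, h1'⟩ | h1 | rfl
  · rcases h2 with ⟨h2, h2'⟩ | h2 | rfl
    · exact Or.inl ⟨h1, h2'⟩
    · exact absurd h2.1 h1'.ne
    · exact Or.inl ⟨h1, h1'⟩
  · rcases h2 with ⟨h2, h2'⟩ | h2 | rfl
    · exact absurd h1.2.1 h2.ne
    · exact Or.inr (Or.inl (E.nu_trans hN h1 h2))
    · exact Or.inr (Or.inl h1)
  · exact h2

/-- The congruence `R_N` of `P`, for a normal subgroup `N` of `S_q`. -/
def SymIdentification.RCon {X : Type*} [Finite X] {r : ℕ} {A : IdempotentMap X r} {q : ℕ}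
    (E : A.SymIdentification q) (N : Subgroup (Equiv.Perm (Fin q))) (hN : N.Normal) :
    Con A.P where
  r := E.RRel N
  iseqv := by
    refine ⟨fun f => Or.inr (Or.inr rfl), ?_, E.RRel_trans hN⟩
    rintro f g (⟨h, h'⟩ | h | rfl)
    · exact Or.inl ⟨h', h⟩
    · exact Or.inr (Or.inl (E.nu_symm h))
    · exact Or.inr (Or.inr rfl)
  mul' := by
    intro f f' g g' hf hg
    apply E.RRel_trans hN (g := f' * g)
    · rcases hf with ⟨h, h'⟩ | ⟨-, -, u, v, x, y, hx, hy, h1, h2⟩ | rfl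
      · exact Or.inl ⟨(RegVariant.rank_le_right (WithOne.coe_mul f g)).trans_lt h,
          (RegVariant.rank_le_right (WithOne.coe_mul f' g)).trans_lt h'⟩
      · exact E.RRel_of_eq_mul (u := u) (v := v * g) hx hy
          (by rw [WithOne.coe_mul, h1, mul_assoc]) (by rw [WithOne.coe_mul, h2, mul_assoc])
      · exact Or.inr (Or.inr rfl)
    · rcases hg with ⟨h, h'⟩ | ⟨-, -, u, v, x, y, hx, hy, h1, h2⟩ | rfl
      · exact Or.inl ⟨(RegVariant.rank_le_left (WithOne.coe_mul f' g)).trans_lt h,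
          (RegVariant.rank_le_left (WithOne.coe_mul f' g')).trans_lt h'⟩
      · exact E.RRel_of_eq_mul (u := f' * u) (v := v) hx hy
          (by rw [WithOne.coe_mul, h1]; simp only [mul_assoc])
          (by rw [WithOne.coe_mul, h2]; simp only [mul_assoc])
      · exact Or.inr (Or.inr rfl)

/-! ### Decomposition data -/

/-- The data of a decomposition: a normal subgroup `N` of `S_q` for some `1 ≤ q ≤ r`, a `𝒫`-system
`Ψ₁` and a `𝒞`-system `Ψ₂`, both of rank at least `q - 1`. -/
structure DecompositionData {X : Type*} {r : ℕ} (A : IdempotentMap X r) where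
  q : ℕ
  one_le_q : 1 ≤ q
  q_le : q ≤ r
  N : Subgroup (Equiv.Perm (Fin q))
  normal : N.Normal
  Ψ₁ : A.PSystem
  Ψ₂ : A.CSystem
  rank_Ψ₁ : q - 1 ≤ Ψ₁.rank
  rank_Ψ₂ : q - 1 ≤ Ψ₂.rank

end IdempotentMap

/-! ### Congruences generated by commuting congruences -/

/-! Let `k` be the largest rank such that `σ` identifies all elements of rank at most `k`; since `σ`
is not universal, `k < r`, and `q = k + 1`. The crux is a collapsing dichotomy
(`collapses_succ_or`). If `σ` relates `f` and `g`, where `f` has the larger rank and this exceeds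
`k`, then multiplying the pair by suitable elements either yields a pair of rank `k + 1` and rank at
most `k`, which would collapse the next ideal, or shows that `f` and `g` are `κ`-related, or that
both have rank `q` and agree up to `κ` in image and kernel. In the last case `g` can be moved modulo
`κ` into the `ℋ`-class of `f` (`exists_greenH_kappa`), and the resulting pair lies in `ν_N`, with
`N` the set of permutations that `σ` identifies with `1` (`nu_conSubgroup`). A `κ`-pair splits into
a `ρ`-pair and a `λ`-pair that both stay in `σ` (`exists_rho_lam`). Hence `σ` is the join of `R_N`,
`σ ∩ λ` and `σ ∩ ρ`.

The restrictions `σ ∩ λ` and `σ ∩ ρ` are exactly of the form `λ(Ψ₁)` and `ρ(Ψ₂)`. Each class of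
elements with a given kernel (or image) has a representative idempotent-like element, `proj` (or
`sect`), that fixes the class under multiplication, so `σ` is determined there by its values on
representatives.

The three congruences commute pairwise, so the join is the composite (`sup_iff`). From a composite
chain between elements of rank at least `q` the factors can be read off: `R_N` moves nothing outside
an `ℋ`-class, `λ` preserves images, `ρ` preserves kernels, and `λ ∩ 𝓡` and `ρ ∩ 𝓛` are trivial. Thus
`Ψ₁`, `Ψ₂` and `N` are recovered from the join, and `q` is recovered because the join preserves
images modulo `a` in rank `q`. -/

/-- The join of two commuting congruences is their composite. -/
theorem Con.sup_iff_of_commute {M : Type*} [Mul M] {c d : Con M}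
    (h : ∀ x y z, c x y → d y z → ∃ w, d x w ∧ c w z) (x z : M) :
    (c ⊔ d) x z ↔ ∃ y, c x y ∧ d y z := by
  let e : Con M :=
    { r := fun x z => ∃ y, c x y ∧ d y z
      iseqv := by
        refine ⟨fun x => ⟨x, c.refl x, d.refl x⟩, ?_, ?_⟩
        · rintro x z ⟨y, h1, h2⟩
          obtain ⟨w, h3, h4⟩ := h x y z h1 h2
          exact ⟨w, c.symm h4, d.symm h3⟩
        · rintro x z t ⟨y, h1, h2⟩ ⟨y', h3, h4⟩
          obtain ⟨w, h5, h6⟩ := h _ _ _ (c.symm h3) (d.symm h2)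
          exact ⟨w, c.trans h1 (c.symm h6), d.trans (d.symm h5) h4⟩
      mul' := by
        rintro x x' y y' ⟨u, h1, h2⟩ ⟨v, h3, h4⟩
        exact ⟨u * v, c.mul h1 h3, d.mul h2 h4⟩ }
  constructor
  · have : c ⊔ d ≤ e := sup_le (fun x y hxy => ⟨y, hxy, d.refl y⟩)
      (fun x y hxy => ⟨x, c.refl x, hxy⟩)
    exact fun hxz => this hxz
  · rintro ⟨y, h1, h2⟩
    exact (c ⊔ d).trans ((le_sup_left : c ≤ c ⊔ d) h1) ((le_sup_right : d ≤ c ⊔ d) h2)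

namespace RegVariant

/-! ### Elements of `P` and Green's relations -/

/-- The two conditions say that `a` separates the image and that `im(a)` meets every kernel class;
an inverse then picks, for each point of `a(im f)`, a preimage. All elements of `P` needed below are
built through this criterion. -/
theorem mem_regPart_of {X : Type*} {a : X → X} {f : X → X}
    (h1 : ∀ x y, a (f x) = a (f y) → f x = f y) (h2 : ∀ x, ∃ y, f (a y) = f x) :
    f ∈ regPart a := by
  classical
  refine ⟨fun z => if h : ∃ y, a (f (a y)) = z then h.choose else z, ?_⟩
  funext x
  have h : ∃ y, a (f (a y)) = a (f x) := by
    obtain ⟨y, hy⟩ := h2 x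
    exact ⟨y, by rw [hy]⟩
  change f x = f (a (if h : ∃ y, a (f (a y)) = a (f x) then h.choose else a (f x)))
  rw [dif_pos h]
  exact (h1 _ _ h.choose_spec).symm

theorem exists_rep' {X : Type*} {a : X → X} (f : RegVariant a) (x : X) :
    ∃ y, f.fn (a y) = f.fn x := by
  obtain ⟨_, ⟨y, rfl⟩, h⟩ := f.exists_rep x
  exact ⟨y, h⟩

/-- If `g * s * g = g`, then `s * g` fixes every point of `im g` after the sandwich, so it is a
right identity for everything with image inside `im g`. -/
theorem exists_eq_mul_of_im_subset {X : Type*} {a : X → X} {f g : RegVariant a}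
    (h : f.im ⊆ g.im) : ∃ u : RegVariant a, f = u * g := by
  obtain ⟨s, hs⟩ := g.regular
  refine ⟨f * s, ?_⟩
  ext x
  obtain ⟨y, hy⟩ := h ⟨x, rfl⟩
  change f.fn x = g.fn (a (s.fn (a (f.fn x))))
  rw [← hy]
  conv_lhs => rw [← hs]
  rfl

theorem greenL_iff {X : Type*} {a : X → X} {f g : RegVariant a} :
    GreenL f g ↔ f.im = g.im := by
  constructor
  · rintro ⟨⟨u, hu⟩, ⟨v, hv⟩⟩
    exact (im_subset_of_eq_mul hu).antisymm (im_subset_of_eq_mul hv)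
  · intro h
    obtain ⟨u, hu⟩ := exists_eq_mul_of_im_subset h.le
    obtain ⟨v, hv⟩ := exists_eq_mul_of_im_subset h.ge
    exact ⟨⟨u, by rw [← WithOne.coe_mul, ← hu]⟩, ⟨v, by rw [← WithOne.coe_mul, ← hv]⟩⟩

theorem exists_eq_mul_of_ker_le {X : Type*} {a : X → X} {f g : RegVariant a}
    (h : g.ker ≤ f.ker) : ∃ u : RegVariant a, f = g * u := by
  obtain ⟨s, hs⟩ := g.regular
  refine ⟨s * f, ?_⟩
  ext x
  change f.fn x = f.fn (a (s.fn (a (g.fn x))))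
  apply h
  change g.fn x = g.fn (a (s.fn (a (g.fn x))))
  conv_lhs => rw [← hs]
  rfl

theorem greenR_iff {X : Type*} {a : X → X} {f g : RegVariant a} :
    GreenR f g ↔ f.ker = g.ker := by
  constructor
  · rintro ⟨⟨u, hu⟩, ⟨v, hv⟩⟩
    obtain ⟨k, hk⟩ := exists_eq_of_eq_mul hu
    obtain ⟨l, hl⟩ := exists_eq_of_eq_mul hv
    ext x y
    change f.fn x = f.fn y ↔ g.fn x = g.fn y
    exact ⟨fun h => by rw [hl, hl, h], fun h => by rw [hk, hk, h]⟩
  · intro h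
    obtain ⟨u, hu⟩ := exists_eq_mul_of_ker_le h.ge
    obtain ⟨v, hv⟩ := exists_eq_mul_of_ker_le h.le
    exact ⟨⟨u, by rw [← WithOne.coe_mul, ← hu]⟩, ⟨v, by rw [← WithOne.coe_mul, ← hv]⟩⟩

theorem ker_eq_iff {X : Type*} {a : X → X} {f g : RegVariant a} :
    f.ker = g.ker ↔ ∀ x y, f.fn x = f.fn y ↔ g.fn x = g.fn y := by
  rw [Setoid.ext_iff]
  exact Iff.rfl

/-- Under `𝓛` the images coincide and `a` separates their points, so the outer `a` in `afa = aga`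
can be cancelled. Conversely `im(a)` meets every kernel class, so the values there give the whole
image. -/
theorem lam_iff {X : Type*} {a : X → X} {f g : RegVariant a} :
    lam f g ↔ ∀ x, f.fn (a x) = g.fn (a x) := by
  constructor
  · rintro ⟨hk, hL⟩ x
    have h1 : f.fn (a x) ∈ g.im := greenL_iff.1 hL ▸ ⟨_, rfl⟩
    obtain ⟨y, hy⟩ := h1
    rw [← hy]
    apply g.injOn
    rw [hy]
    exact congrFun hk x
  · intro h
    refine ⟨funext fun x => congrArg a (h x), greenL_iff.2 ?_⟩
    ext z
    constructor
    · rintro ⟨x, rfl⟩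
      obtain ⟨y, hy⟩ := f.exists_rep' x
      exact ⟨_, by rw [← hy, h]⟩
    · rintro ⟨x, rfl⟩
      obtain ⟨y, hy⟩ := g.exists_rep' x
      exact ⟨_, by rw [← hy, h]⟩

/-- Dually, under `𝓡` the kernels coincide, so the inner `a` in `afa = aga` can be dropped by
passing to kernel representatives in `im(a)`. -/
theorem rho_iff {X : Type*} {a : X → X} {f g : RegVariant a} :
    rho f g ↔ ∀ x, a (f.fn x) = a (g.fn x) := by
  constructor
  · rintro ⟨hk, hR⟩ x
    obtain ⟨y, hy⟩ := f.exists_rep' x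
    have h2 := (ker_eq_iff.1 (greenR_iff.1 hR) _ _).1 hy
    rw [← hy, ← h2]
    exact congrFun hk y
  · intro h
    refine ⟨funext fun x => h (a x), greenR_iff.2 (ker_eq_iff.2 fun x y => ⟨fun h' => ?_,
      fun h' => ?_⟩)⟩
    · exact g.injOn (by rw [← h, ← h, h'])
    · exact f.injOn (by rw [h, h, h'])

theorem eq_of_lam_of_ker {X : Type*} {a : X → X} {f g : RegVariant a} (h : lam f g)
    (hk : f.ker = g.ker) : f = g := by
  ext x
  obtain ⟨y, hy⟩ := f.exists_rep' x
  rw [← hy, lam_iff.1 h, (ker_eq_iff.1 hk _ _).1 hy]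

theorem eq_of_rho_of_im {X : Type*} {a : X → X} {f g : RegVariant a} (h : rho f g)
    (hi : f.im = g.im) : f = g := by
  ext x
  have h1 : f.fn x ∈ g.im := hi ▸ ⟨x, rfl⟩
  obtain ⟨y, hy⟩ := h1
  rw [← hy]
  exact g.injOn (by rw [hy, rho_iff.1 h])

theorem lam.im_eq {X : Type*} {a : X → X} {f g : RegVariant a} (h : lam f g) : f.im = g.im :=
  greenL_iff.1 h.2

theorem rho.ker_eq {X : Type*} {a : X → X} {f g : RegVariant a} (h : rho f g) : f.ker = g.ker :=
  greenR_iff.1 h.2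

theorem lam.symm {X : Type*} {a : X → X} {f g : RegVariant a} (h : lam f g) : lam g f :=
  ⟨h.1.symm, h.2.symm⟩

theorem lam.trans {X : Type*} {a : X → X} {f g k : RegVariant a} (h : lam f g) (h' : lam g k) :
    lam f k := ⟨h.1.trans h'.1, h.2.trans h'.2⟩

theorem rho.symm {X : Type*} {a : X → X} {f g : RegVariant a} (h : rho f g) : rho g f :=
  ⟨h.1.symm, h.2.symm⟩

theorem rho.trans {X : Type*} {a : X → X} {f g k : RegVariant a} (h : rho f g) (h' : rho g k) :
    rho f k := ⟨h.1.trans h'.1, h.2.trans h'.2⟩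

/-- `κ = ρ ∘ λ`, with the intermediate element in every congruence class of its ends. -/
theorem exists_rho_lam {X : Type*} {a : X → X} {f g : RegVariant a} (h : kappa f g) :
    ∃ k, rho f k ∧ lam k g ∧ ∀ σ : Con (RegVariant a), σ f g → σ f k := by
  obtain ⟨s, hs⟩ := f.regular
  have hs' : ∀ x, f.fn (a (s.fn (a (f.fn x)))) = f.fn x := fun x => by
    conv_rhs => rw [← hs]
    rfl
  have h' : ∀ x, a (f.fn (a x)) = a (g.fn (a x)) := congrFun h
  have hk : ∀ x, a ((f * s * g).fn x) = a (f.fn x) := fun x => by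
    change a (g.fn (a (s.fn (a (f.fn x))))) = _
    rw [← h', hs']
  -- The intermediate element has the kernel of `f` and the image of `g`; it is `σ`-related to `f =
  -- f * s * f` by replacing the last factor.
  refine ⟨f * s * g, rho_iff.2 fun x => (hk x).symm, lam_iff.2 fun x => ?_, fun σ hσ => ?_⟩
  · apply g.injOn (x := a (s.fn (a (f.fn (a x)))))
    exact (hk (a x)).trans (h' x)
  · have := σ.mul (σ.refl (f * s)) hσ
    rwa [hs] at this

/-! ### Ranks -/

theorem im_bar {X : Type*} {a : X → X} (f : RegVariant a) : Set.range f.bar = a '' f.im := by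
  ext z
  constructor
  · rintro ⟨x, rfl⟩
    exact ⟨_, ⟨_, rfl⟩, rfl⟩
  · rintro ⟨_, ⟨x, rfl⟩, rfl⟩
    obtain ⟨y, hy⟩ := f.exists_rep' x
    exact ⟨y, congrArg a hy⟩

/-- Since `a` is injective on `im f` and kernel representatives lie in `im(a)`, passing to `afa`
loses no rank; hence rank is a `κ`-invariant. -/
theorem rank_eq_ncard_bar {X : Type*} {a : X → X} (f : RegVariant a) :
    f.rank = (Set.range f.bar).ncard := by
  rw [im_bar, Set.InjOn.ncard_image, rank]
  rintro _ ⟨x, rfl⟩ _ ⟨y, rfl⟩ h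
  exact f.injOn h

theorem rank_eq_of_kappa {X : Type*} {a : X → X} {f g : RegVariant a} (h : kappa f g) :
    f.rank = g.rank := by
  rw [rank_eq_ncard_bar, rank_eq_ncard_bar, h]

theorem rank_le_ncard_range {X : Type*} [Finite X] {a : X → X} (f : RegVariant a) :
    f.rank ≤ (Set.range a).ncard := by
  rw [rank_eq_ncard_bar]
  refine Set.ncard_le_ncard ?_ (Set.toFinite _)
  rintro _ ⟨x, rfl⟩
  exact ⟨_, rfl⟩

theorem rank_pos {X : Type*} [Finite X] [Nonempty X] {a : X → X} (f : RegVariant a) :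
    0 < f.rank :=
  (Set.ncard_pos (Set.toFinite _)).2 (Set.range_nonempty _)

theorem rank_mul_le_left {X : Type*} [Finite X] {a : X → X} (f g : RegVariant a) :
    (f * g).rank ≤ f.rank := rank_le_right (WithOne.coe_mul f g)

theorem rank_mul_le_right {X : Type*} [Finite X] {a : X → X} (f g : RegVariant a) :
    (f * g).rank ≤ g.rank := rank_le_left (WithOne.coe_mul f g)

theorem im_mul {X : Type*} {a : X → X} (f g : RegVariant a) :
    (f * g).im = (fun y => g.fn (a y)) '' f.im := by
  rw [im, im, ← Set.range_comp]
  rfl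

/-- A product has smaller rank than its first factor if the second one identifies two points. -/
theorem rank_mul_lt {X : Type*} [Finite X] {a : X → X} {f g : RegVariant a} {x y : X}
    (h : f.fn x ≠ f.fn y) (h' : (f * g).fn x = (f * g).fn y) : (f * g).rank < f.rank := by
  refine lt_of_le_of_ne (rank_mul_le_left f g) fun heq => h ?_
  have : Set.InjOn (fun y => g.fn (a y)) f.im := by
    apply Set.injOn_of_ncard_image_eq _ (Set.toFinite _)
    rw [← im_mul]
    exact heq
  exact this ⟨x, rfl⟩ ⟨y, rfl⟩ h'

/-- The elements of rank at most `rank f` are the multiples of `f`. -/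
theorem exists_eq_mul_mul {X : Type*} [Finite X] [Nonempty X] {a : X → X}
    (ha : ∀ x, a (a x) = a x) {f h : RegVariant a} (hr : h.rank ≤ f.rank) :
    ∃ u v : RegVariant a, h = u * f * v := by
  classical
  -- `φ` encodes the points of `im h` as points of `im f`. The left factor `u` makes `u * f` equal
  -- to `h` followed by `φ`, and the right factor decodes. The value outside the code is an
  -- arbitrary point of `im h`, which keeps the decoder regular.
  obtain ⟨φ, hφ1, hφ2⟩ : ∃ φ : X → X, (∀ y ∈ h.im, φ y ∈ f.im) ∧ Set.InjOn φ h.im := by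
    obtain ⟨φ, h1, h2⟩ := (Set.toFinite h.im).exists_injOn_of_encard_le (t := f.im) (by
      rw [← (Set.toFinite h.im).cast_ncard_eq, ← (Set.toFinite f.im).cast_ncard_eq]
      exact_mod_cast hr)
    exact ⟨φ, fun y hy => h1 hy, h2⟩
  have hφ3 : ∀ y, ∃ z, y ∈ h.im → f.fn (a z) = φ y := fun y => by
    by_cases hy : y ∈ h.im
    · obtain ⟨x, hx⟩ := hφ1 y hy
      obtain ⟨z, hz⟩ := f.exists_rep' x
      exact ⟨z, fun _ => hz.trans hx⟩
    · exact ⟨y, fun h => absurd h hy⟩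
  choose ψ hψ using hφ3
  let u : RegVariant a := ⟨fun x => a (ψ (h.fn x)), mem_regPart_of (fun x y hxy => by
    simpa only [ha] using hxy) (fun x => by
      obtain ⟨y, hy⟩ := h.exists_rep' x
      exact ⟨y, by rw [hy]⟩)⟩
  obtain ⟨x0⟩ := ‹Nonempty X›
  have hv : ∀ z, ∃ y, y ∈ h.im ∧ ((∃ y' ∈ h.im, a (φ y') = z) → a (φ y) = z) := fun z => by
    by_cases hz : ∃ y' ∈ h.im, a (φ y') = z
    · obtain ⟨y', h1, h2⟩ := hz
      exact ⟨y', h1, fun _ => h2⟩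
    · exact ⟨h.fn x0, ⟨_, rfl⟩, fun h => absurd h hz⟩
  choose v hv1 hv2 using hv
  have hvinj : ∀ x y, a (v x) = a (v y) → v x = v y := fun x y hxy => by
    obtain ⟨x', hx'⟩ := hv1 x
    obtain ⟨y', hy'⟩ := hv1 y
    rw [← hx', ← hy'] at hxy ⊢
    exact h.injOn hxy
  refine ⟨u, ⟨fun z => v (a z), mem_regPart_of (fun x y => hvinj _ _) fun x => ⟨x, by rw [ha]⟩⟩, ?_⟩
  ext x
  change h.fn x = v (a (a (f.fn (a (a (ψ (h.fn x)))))))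
  rw [ha, ha, hψ _ ⟨x, rfl⟩]
  have h1 := hv2 (a (φ (h.fn x))) ⟨_, ⟨x, rfl⟩, rfl⟩
  apply hφ2 ⟨x, rfl⟩ (hv1 _)
  obtain ⟨y, hy⟩ := hφ1 _ (hv1 (a (φ (h.fn x))))
  obtain ⟨z, hz⟩ := hφ1 (h.fn x) ⟨x, rfl⟩
  generalize v (a (φ (h.fn x))) = t at *
  rw [← hy, ← hz] at h1 ⊢
  exact (f.injOn h1).symm

end RegVariant

namespace RegVariant

/-! ### Congruences collapsing an ideal -/

/-- The congruence `σ` collapses the ideal of all elements of rank at most `k`. -/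
def Collapses {X : Type*} {a : X → X} (σ : Con (RegVariant a)) (k : ℕ) : Prop :=
  ∀ f g : RegVariant a, f.rank ≤ k → g.rank ≤ k → σ f g

theorem eq_const_of_rank_le_one {X : Type*} [Finite X] {a : X → X} {f : RegVariant a}
    (h : f.rank ≤ 1) (x y : X) : f.fn x = f.fn y :=
  (Set.ncard_le_one (Set.toFinite _)).1 h _ ⟨x, rfl⟩ _ ⟨y, rfl⟩

/-- The constant map with value `z`. -/
def const {X : Type*} (a : X → X) (z : X) : RegVariant a :=
  ⟨fun _ => z, mem_regPart_of (fun _ _ _ => rfl) fun x => ⟨x, rfl⟩⟩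

/-- Multiplying by a constant on the left turns the pair into two constants in different `a`-blocks,
and a two-valued map on the right sends these to any two constants in different blocks. Two
constants in the same block are joined through a third one. -/
theorem collapses_one {X : Type*} [Finite X] [Nonempty X] {a : X → X} (ha : ∀ x, a (a x) = a x)
    {σ : Con (RegVariant a)} {f g : RegVariant a} (h : σ f g) (hk : ¬ kappa f g) :
    Collapses σ 1 := by
  classical
  obtain ⟨x, hx⟩ := Function.ne_iff.1 hk
  have key : ∀ z w, a z ≠ a w → σ (const a z) (const a w) := by
    intro z w hzw
    let v : RegVariant a := ⟨fun y => if a y = a (f.fn (a x)) then z else w,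
      mem_regPart_of (fun s t hst => by
        split_ifs at hst ⊢ <;> first | rfl | exact absurd hst hzw | exact absurd hst.symm hzw)
        fun y => ⟨y, by rw [ha]⟩⟩
    have h1 := σ.mul (σ.mul (σ.refl (const a x)) h) (σ.refl v)
    have h2 : const a x * f * v = const a z := by
      ext y
      change (if a (a (f.fn (a x))) = a (f.fn (a x)) then z else w) = z
      rw [if_pos (ha _)]
    have h3 : const a x * g * v = const a w := by
      ext y
      change (if a (a (g.fn (a x))) = a (f.fn (a x)) then z else w) = w
      rw [if_neg]
      rw [ha]
      exact fun h => hx h.symm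
    rwa [h2, h3] at h1
  have key' : ∀ z w, σ (const a z) (const a w) := by
    intro z w
    by_cases hzw : a z = a w
    · by_cases hz : a z = a (f.fn (a x))
      · have : a z ≠ a (g.fn (a x)) := fun h => hx (hz.symm.trans h)
        exact σ.trans (key _ _ this) (key _ _ (by rw [← hzw]; exact this.symm))
      · exact σ.trans (key _ _ hz) (key _ _ (by rw [← hzw]; exact fun h => hz h.symm))
    · exact key z w hzw
  intro f g hf hg
  have hc : ∀ f : RegVariant a, f.rank ≤ 1 → f = const a (f.fn x) := fun f hf => by
    ext y
    exact eq_const_of_rank_le_one hf y x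
  rw [hc f hf, hc g hg]
  exact key' _ _

/-- Every element of rank at most `k + 1` is a multiple `u * f * v`, hence `σ`-related to `u * g *
v`, whose rank is at most `k`. -/
theorem collapses_succ {X : Type*} [Finite X] [Nonempty X] {a : X → X}
    (ha : ∀ x, a (a x) = a x) {σ : Con (RegVariant a)} {k : ℕ} (hc : Collapses σ k)
    {f g : RegVariant a} (h : σ f g) (hf : f.rank = k + 1) (hg : g.rank ≤ k) :
    Collapses σ (k + 1) := by
  have key : ∀ h : RegVariant a, h.rank ≤ k + 1 → ∃ h', h'.rank ≤ k ∧ σ h h' := by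
    intro h' hh
    obtain ⟨u, v, rfl⟩ := exists_eq_mul_mul ha (hh.trans hf.ge)
    exact ⟨u * g * v, ((rank_mul_le_left _ _).trans (rank_mul_le_right _ _)).trans hg,
      σ.mul (σ.mul (σ.refl u) h) (σ.refl v)⟩
  intro f g hf hg
  obtain ⟨f', h1, h2⟩ := key f hf
  obtain ⟨g', h3, h4⟩ := key g hg
  exact σ.trans h2 (σ.trans (hc _ _ h1 h3) (σ.symm h4))

/-- A right multiplier that fixes `im f` and throws every `a`-block missed by `im f` onto one point
`z0` keeps `f` but drops the rank of `g` to at most `k`. -/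
theorem collapses_succ_of_im {X : Type*} [Finite X] [Nonempty X] {a : X → X}
    (ha : ∀ x, a (a x) = a x) {σ : Con (RegVariant a)} {k : ℕ} (hk : 1 ≤ k)
    (hc : Collapses σ k) {f g : RegVariant a} (h : σ f g) (hf : f.rank = k + 1)
    (hg : g.rank ≤ k + 1) {x : X} (hx : ∀ y, a (f.fn y) ≠ a (g.fn x)) :
    Collapses σ (k + 1) := by
  classical
  -- If some block meets both images, `z0` is taken there, so that the missed value `g x` is merged
  -- with another value of `g`. Otherwise `g` becomes constant, which is small enough because `1 ≤
  -- k`.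
  obtain ⟨z0, hz0, hz⟩ : ∃ z0 ∈ f.im, (∃ y, a (g.fn y) = a z0) ∨ ∀ y, ∀ z ∈ f.im,
      a z ≠ a (g.fn y) := by
    by_cases hz : ∃ y, ∃ z ∈ f.im, a z = a (g.fn y)
    · obtain ⟨y, z, h1, h2⟩ := hz
      exact ⟨z, h1, Or.inl ⟨y, h2.symm⟩⟩
    · push Not at hz
      exact ⟨f.fn x, ⟨x, rfl⟩, Or.inr hz⟩
  have hv : ∀ y, ∃ z ∈ f.im, (∀ w ∈ f.im, a w = y → z = w) ∧ ((∀ w ∈ f.im, a w ≠ y) → z = z0) := by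
    intro y
    by_cases hy : ∃ w ∈ f.im, a w = y
    · obtain ⟨w, ⟨t, rfl⟩, h2⟩ := hy
      refine ⟨f.fn t, ⟨t, rfl⟩, ?_, fun h => absurd h2 (h _ ⟨t, rfl⟩)⟩
      rintro _ ⟨w, rfl⟩ h3
      exact f.injOn (h2.trans h3.symm)
    · push Not at hy
      exact ⟨z0, hz0, fun w h1 h2 => absurd h2 (hy w h1), fun _ => rfl⟩
  choose v hv1 hv2 hv3 using hv
  let V : RegVariant a := ⟨fun y => v (a y), mem_regPart_of (fun s t hst => by
    obtain ⟨s', hs⟩ := hv1 (a s)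
    obtain ⟨t', ht⟩ := hv1 (a t)
    rw [← hs, ← ht] at hst ⊢
    exact f.injOn hst) fun y => ⟨y, by rw [ha]⟩⟩
  have hfV : f * V = f := by
    ext y
    change v (a (a (f.fn y))) = f.fn y
    rw [ha]
    exact hv2 _ _ ⟨y, rfl⟩ rfl
  have hgV : ∀ y, (g * V).fn y = v (a (g.fn y)) := fun y => by
    change v (a (a (g.fn y))) = _
    rw [ha]
  have hgx : (g * V).fn x = z0 := by
    rw [hgV]
    apply hv3
    rintro _ ⟨y, rfl⟩
    exact hx y
  have h1 := σ.mul h (σ.refl V)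
  rw [hfV] at h1
  refine collapses_succ ha hc h1 hf ?_
  rcases hz with ⟨y, hy⟩ | hz
  · have hlt : (g * V).rank < g.rank := by
      apply rank_mul_lt (x := x) (y := y)
      · intro hxy
        obtain ⟨t, rfl⟩ := hz0
        exact hx t (by rw [hxy, hy])
      · rw [hgx, hgV, hv2 _ z0 hz0 hy.symm]
    omega
  · refine le_trans ?_ hk
    refine (Set.ncard_le_one (Set.toFinite _)).2 ?_
    have : ∀ y, (g * V).fn y = z0 := fun y => by
      rw [hgV]
      exact hv3 _ (hz y)
    rintro _ ⟨s, rfl⟩ _ ⟨t, rfl⟩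
    rw [this, this]

/-- Dually, a left multiplier sends each point to a representative, in `im(a)`, of its `ker
f`-class, with `a x` and `a y` among the representatives. It fixes `f`, has rank at most `k + 1`,
and loses rank when followed by `g`. -/
theorem collapses_succ_of_ker {X : Type*} [Finite X] [Nonempty X] {a : X → X}
    (ha : ∀ x, a (a x) = a x) {σ : Con (RegVariant a)} {k : ℕ}
    (hc : Collapses σ k) {f g : RegVariant a} (h : σ f g) (hf : f.rank = k + 1)
    {x y : X} (hfxy : f.fn (a x) ≠ f.fn (a y)) (hgxy : g.fn (a x) = g.fn (a y)) :
    Collapses σ (k + 1) := by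
  classical
  have hu' : ∃ u : X → X, (∀ z, f.fn (a (u (f.fn z))) = f.fn z) ∧ u (f.fn (a x)) = x ∧
      u (f.fn (a y)) = y := by
    refine ⟨fun w => if w = f.fn (a x) then x else if w = f.fn (a y) then y else
      if h : ∃ t, f.fn (a t) = w then h.choose else w, fun z => ?_, ?_, ?_⟩
    · dsimp only
      split_ifs with h1 h2 h3
      · exact h1.symm
      · exact h2.symm
      · exact h3.choose_spec
      · exact absurd (f.exists_rep' z) h3
    · simp
    · simp [hfxy.symm]
  obtain ⟨u, hu1, hux, huy⟩ := hu'
  let U : RegVariant a := ⟨fun z => a (u (f.fn z)), mem_regPart_of (fun s t hst => by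
    simpa only [ha] using hst) fun z => by
      obtain ⟨w, hw⟩ := f.exists_rep' z
      exact ⟨w, by rw [hw]⟩⟩
  have hUf : U * f = f := by
    ext z
    change f.fn (a (a (u (f.fn z)))) = f.fn z
    rw [ha, hu1]
  have hUrank : U.rank ≤ k + 1 := by
    rw [← hf]
    have : U.im = (fun w => a (u w)) '' f.im := by
      rw [im, im, ← Set.range_comp]
      rfl
    rw [rank, this]
    exact Set.ncard_image_le (Set.toFinite _)
  have h1 := σ.mul (σ.refl U) h
  rw [hUf] at h1
  refine collapses_succ ha hc h1 hf ?_
  have hlt : (U * g).rank < U.rank := by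
    apply rank_mul_lt (x := a x) (y := a y)
    · change a (u (f.fn (a x))) ≠ a (u (f.fn (a y)))
      rw [hux, huy]
      exact fun h => hfxy (by rw [h])
    · change g.fn (a (a (u (f.fn (a x))))) = g.fn (a (a (u (f.fn (a y)))))
      rw [hux, huy, ha, ha, hgxy]
  omega

/-- A pair of elements that are not `κ`-related has multiples of a given smaller rank whose
images are different modulo `a`. -/
theorem exists_mul_im_ne {X : Type*} [Finite X] [Nonempty X] {a : X → X}
    (ha : ∀ x, a (a x) = a x) {k : ℕ} (hk : 1 ≤ k) {f g : RegVariant a} (hf : k < f.rank)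
    {x : X} (hx : a (f.fn (a x)) ≠ a (g.fn (a x))) :
    ∃ u : RegVariant a, (u * f).rank = k ∧ (u * g).rank ≤ k ∧
      ∀ y, a ((u * f).fn y) ≠ a ((u * g).fn (a x)) := by
  classical
  -- At most one point of `im f` lies in the block of `g (a x)`, so after discarding it there is
  -- still room for a `k`-element set `W` containing `f (a x)`. The multiplier makes `u * f` the map
  -- `f` followed by a retraction onto `W`, while leaving `g (a x)` unchanged.
  have h1 : f.im.ncard ≤ (f.im \ {w | w ∈ f.im ∧ a w = a (g.fn (a x))}).ncard + 1 := by
    have : {w | w ∈ f.im ∧ a w = a (g.fn (a x))}.ncard ≤ 1 := by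
      rw [Set.ncard_le_one (Set.toFinite _)]
      rintro _ ⟨⟨s, rfl⟩, hs⟩ _ ⟨⟨t, rfl⟩, ht⟩
      exact f.injOn (hs.trans ht.symm)
    have h2 := Set.ncard_sdiff_add_ncard_of_subset
      (s := {w | w ∈ f.im ∧ a w = a (g.fn (a x))}) (t := f.im) (fun _ h => h.1) (Set.toFinite _)
    omega
  obtain ⟨W, hW1, hW2, hW3⟩ := Set.exists_subsuperset_card_eq (n := k)
    (s := {f.fn (a x)}) (t := f.im \ {w | w ∈ f.im ∧ a w = a (g.fn (a x))})
    (by rintro _ rfl; exact ⟨⟨_, rfl⟩, fun h => hx h.2⟩) (by rw [Set.ncard_singleton]; exact hk)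
    (by change k < f.im.ncard at hf; omega)
  have hxW : f.fn (a x) ∈ W := hW1 rfl
  obtain ⟨u, hu1, hux⟩ : ∃ u : X → X, (∀ z ∈ f.im, f.fn (a (u z)) = z) ∧ u (f.fn (a x)) = x := by
    refine ⟨fun w => if w = f.fn (a x) then x else
      if h : ∃ t, f.fn (a t) = w then h.choose else w, ?_, by simp⟩
    rintro _ ⟨z, rfl⟩
    dsimp only
    split_ifs with h1 h3
    · exact h1.symm
    · exact h3.choose_spec
    · exact absurd (f.exists_rep' z) h3
  let p : X → X := fun w => if w ∈ W then w else f.fn (a x)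
  have hp : ∀ w, p w ∈ W := fun w => by
    dsimp only [p]
    split_ifs with h
    · exact h
    · exact hxW
  have hpW : ∀ w ∈ W, p w = w := fun w hw => if_pos hw
  let U : RegVariant a := ⟨fun z => a (u (p (f.fn z))), mem_regPart_of (fun s t hst => by
    simpa only [ha] using hst) fun z => by
      obtain ⟨w, hw⟩ := f.exists_rep' z
      exact ⟨w, by rw [hw]⟩⟩
  have hUf : ∀ z, (U * f).fn z = p (f.fn z) := fun z => by
    change f.fn (a (a (u (p (f.fn z))))) = _
    rw [ha, hu1 _ (hW2 (hp _)).1]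
  have hUim : (U * f).im = W := by
    ext w
    constructor
    · rintro ⟨z, rfl⟩
      rw [hUf]
      exact hp _
    · intro hw
      obtain ⟨z, rfl⟩ := (hW2 hw).1
      exact ⟨z, by rw [hUf, hpW _ hw]⟩
  refine ⟨U, by rw [rank, hUim, hW3], ?_, fun y => ?_⟩
  · refine (rank_mul_le_left U g).trans ?_
    have : U.im ⊆ (fun w => a (u w)) '' W := by
      rintro _ ⟨z, rfl⟩
      exact ⟨p (f.fn z), hp _, rfl⟩
    rw [← hW3]
    exact (Set.ncard_le_ncard this (Set.toFinite _)).trans (Set.ncard_image_le (Set.toFinite _))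
  · have h2 : (U * g).fn (a x) = g.fn (a x) := by
      change g.fn (a (a (u (p (f.fn (a x)))))) = _
      rw [ha, hpW _ hxW, hux]
    rw [hUf, h2]
    exact fun h => (hW2 (hp _)).2 ⟨(hW2 (hp _)).1, h⟩

/-- The collapsing step: a congruence that collapses the elements of rank at most `k` and relates
`f` and `g`, of rank at most `rank f > k`, collapses the elements of rank at most `k + 1`, unless
`f` and `g` are `κ`-related, or of rank `k + 1` and `ℋ`-related modulo `κ`. -/
theorem collapses_succ_or {X : Type*} [Finite X] [Nonempty X] {a : X → X}
    (ha : ∀ x, a (a x) = a x) {σ : Con (RegVariant a)} {k : ℕ}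
    (hc : Collapses σ k) {f g : RegVariant a} (h : σ f g) (hf : k < f.rank)
    (hg : g.rank ≤ f.rank) :
    Collapses σ (k + 1) ∨ kappa f g ∨ (f.rank = k + 1 ∧ g.rank = k + 1 ∧
      (∀ x, ∃ y, a (f.fn y) = a (g.fn x)) ∧
      ∀ x y, f.fn (a x) = f.fn (a y) ↔ g.fn (a x) = g.fn (a y)) := by
  by_cases hkap : kappa f g
  · exact Or.inr (Or.inl hkap)
  have h1 := collapses_one ha h hkap
  rcases Nat.eq_zero_or_pos k with rfl | hk
  · exact Or.inl h1
  -- Above rank `k + 1`, failure of `κ` alone suffices: the pair is cut down to rank exactly `k + 1`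
  -- with an image still distinguishing it.
  rcases Nat.lt_or_ge (k + 1) f.rank with hlt | hge
  · left
    obtain ⟨x, hx⟩ := Function.ne_iff.1 hkap
    obtain ⟨u, h2, h3, h4⟩ := exists_mul_im_ne ha (Nat.le_add_left 1 k) hlt hx
    exact collapses_succ_of_im ha hk hc (σ.mul (σ.refl u) h) h2 h3 h4
  have hf' : f.rank = k + 1 := by omega
  rcases Nat.lt_or_ge g.rank (k + 1) with hlt | hge'
  · exact Or.inl (collapses_succ ha hc h hf' (by omega))
  have hg' : g.rank = k + 1 := by omega
  by_contra! hcon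
  obtain ⟨hcon, -, h2⟩ := hcon
  obtain ⟨x, y, hxy⟩ := h2 hf' hg' fun x => by
    by_contra! hx
    exact hcon (collapses_succ_of_im ha hk hc h hf' hg'.le hx)
  rcases hxy with ⟨h3, h4⟩ | ⟨h3, h4⟩
  · exact hcon (collapses_succ_of_ker ha hc (σ.symm h) hg' h4 h3)
  · exact hcon (collapses_succ_of_ker ha hc h hf' h3 h4)

/-- An element related to `g` modulo `κ` in the `ℋ`-class of `f`. -/
theorem exists_greenH_kappa {X : Type*} [Finite X] {a : X → X} {σ : Con (RegVariant a)}
    {f g : RegVariant a} (h : σ f g)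
    (him : ∀ x, ∃ y, a (f.fn y) = a (g.fn x))
    (hker : ∀ x y, f.fn (a x) = f.fn (a y) ↔ g.fn (a x) = g.fn (a y)) :
    ∃ k, σ f k ∧ kappa k g ∧ (∃ c, k = f * c) ∧ ∃ d, k = d * f := by
  obtain ⟨s, hs⟩ := f.regular
  have hs' : ∀ x, f.fn (a (s.fn (a (f.fn x)))) = f.fn x := fun x => by
    conv_rhs => rw [← hs]
    rfl
  -- Multiplying by `f * s` on the left and `s * f` on the right fixes `f` and turns `g` into a
  -- two-sided multiple of `f`. Because kernels on `im(a)` agree and the image of `g` modulo `a`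
  -- lies in that of `f`, `g` is unchanged modulo `κ`.
  refine ⟨f * s * g * s * f, ?_, ?_, ⟨s * g * s * f, by simp only [mul_assoc]⟩, ⟨_, rfl⟩⟩
  · have := σ.mul (σ.mul (σ.mul (σ.refl (f * s)) h) (σ.refl s)) (σ.refl f)
    rwa [hs, hs] at this
  · funext x
    change a (f.fn (a (s.fn (a (g.fn (a (s.fn (a (f.fn (a x)))))))))) = a (g.fn (a x))
    rw [(hker _ _).1 (hs' (a x))]
    obtain ⟨y, hy⟩ := him (a x)
    rw [← hy, hs']

end RegVariant

namespace IdempotentMap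

open RegVariant

theorem exists_pt {X : Type*} {r : ℕ} (A : IdempotentMap X r) (x : X) : ∃ i, A.a x = A.pt i :=
  A.exists_block x

/-! ### Representatives of `𝓡`-classes -/

/-- The class representative of `i` for the partition `I` of `[r]`. -/
noncomputable def repr {r : ℕ} (I : Setoid (Fin r)) (i : Fin r) : Fin r := (Quotient.mk I i).out

theorem repr_rel {r : ℕ} (I : Setoid (Fin r)) (i : Fin r) : I (repr I i) i :=
  Quotient.mk_out (s := I) i

theorem repr_eq {r : ℕ} {I : Setoid (Fin r)} {i j : Fin r} (h : I i j) : repr I i = repr I j :=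
  congrArg Quotient.out (Quotient.sound (s := I) h)

/-- The element of `P` that maps each block `P_I` of the partition `S` to a point `a_i`, for a chosen
`i ∈ I`. -/
noncomputable def PartitionOver.proj {X : Type*} {r : ℕ} {A : IdempotentMap X r}
    {I : Setoid (Fin r)} (S : A.PartitionOver I) : A.P :=
  ⟨fun x => A.pt (repr I (S.2.1 x).choose), mem_regPart_of
    (fun x y h => by rwa [A.a_pt, A.a_pt] at h)
    (fun x => by
      refine ⟨A.pt (S.2.1 x).choose, ?_⟩
      rw [A.a_pt]
      refine congrArg A.pt (repr_eq ((S.2.2 _ _).1 ?_))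
      exact S.1.symm (S.2.1 (A.pt (S.2.1 x).choose)).choose_spec)⟩

theorem PartitionOver.proj_fn {X : Type*} {r : ℕ} {A : IdempotentMap X r}
    {I : Setoid (Fin r)} (S : A.PartitionOver I) {x : X} {i : Fin r} (h : S.1 x (A.pt i)) :
    S.proj.fn x = A.pt (repr I i) :=
  congrArg A.pt (repr_eq ((S.2.2 _ _).1 (S.1.trans (S.1.symm (S.2.1 x).choose_spec) h)))

theorem PartitionOver.proj_pt {X : Type*} {r : ℕ} {A : IdempotentMap X r}
    {I : Setoid (Fin r)} (S : A.PartitionOver I) (i : Fin r) :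
    S.proj.fn (A.pt i) = A.pt (repr I i) := S.proj_fn (S.1.refl _)

theorem PartitionOver.rel_proj {X : Type*} {r : ℕ} {A : IdempotentMap X r}
    {I : Setoid (Fin r)} (S : A.PartitionOver I) (x : X) : S.1 (S.proj.fn x) x := by
  obtain ⟨i, hi⟩ := S.2.1 x
  rw [S.proj_fn hi]
  exact S.1.trans ((S.2.2 _ _).2 (repr_rel I i)) (S.1.symm hi)

theorem PartitionOver.ker_proj {X : Type*} {r : ℕ} {A : IdempotentMap X r}
    {I : Setoid (Fin r)} (S : A.PartitionOver I) : S.proj.ker = S.1 := by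
  ext x y
  constructor
  · intro h
    have h' : S.proj.fn x = S.proj.fn y := h
    exact S.1.trans (S.1.symm (S.rel_proj x)) (h' ▸ S.rel_proj y)
  · intro h
    obtain ⟨i, hi⟩ := S.2.1 y
    exact (S.proj_fn (S.1.trans h hi)).trans (S.proj_fn hi).symm

theorem PartitionOver.a_proj {X : Type*} {r : ℕ} {A : IdempotentMap X r}
    {I : Setoid (Fin r)} (S : A.PartitionOver I) (x : X) : A.a (S.proj.fn x) = S.proj.fn x :=
  A.a_pt _

theorem PartitionOver.lam_proj {X : Type*} {r : ℕ} {A : IdempotentMap X r}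
    {I : Setoid (Fin r)} (S S' : A.PartitionOver I) : lam S.proj S'.proj := by
  rw [lam_iff]
  intro x
  obtain ⟨i, hi⟩ := A.exists_pt x
  rw [hi, S.proj_pt, S'.proj_pt]

/-- `proj` moves each point within its block to a point fixed by `a`, which `f` cannot notice. So
`proj` is a left identity for all elements whose kernel contains the partition. -/
theorem PartitionOver.proj_mul {X : Type*} {r : ℕ} {A : IdempotentMap X r}
    {I : Setoid (Fin r)} (S : A.PartitionOver I) {f : A.P} (h : S.1 ≤ f.ker) :
    S.proj * f = f := by
  ext x
  rw [mul_fn, S.a_proj]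
  exact h (S.rel_proj x)

theorem PartitionOver.rank_proj {X : Type*} {r : ℕ} {A : IdempotentMap X r}
    {I : Setoid (Fin r)} (S : A.PartitionOver I) : S.proj.rank = Nat.card (Quotient I) := by
  have : S.proj.im = Set.range fun c : Quotient I => A.pt c.out := by
    ext y
    constructor
    · rintro ⟨x, rfl⟩
      exact ⟨_, rfl⟩
    · rintro ⟨c, rfl⟩
      refine ⟨A.pt c.out, ?_⟩
      rw [S.proj_pt, repr, Quotient.out_eq]
  rw [rank, this, ← Set.image_univ, Set.ncard_image_of_injective, Set.ncard_univ]
  exact A.pt_injective.comp fun x y h => by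
    rw [← Quotient.out_eq x, ← Quotient.out_eq y]
    exact congrArg _ h

/-- A congruence relating two `λ`-related elements relates the representatives of their
`𝓡`-classes. -/
theorem PartitionOver.proj_rel {X : Type*} {r : ℕ} {A : IdempotentMap X r}
    {I : Setoid (Fin r)} {S S' : A.PartitionOver I} {σ : Con A.P} {f g : A.P} (h : σ f g)
    (hl : lam f g) (hf : f.ker = S.1) (hg : g.ker = S'.1) : σ S.proj S'.proj := by
  obtain ⟨u, hu⟩ := exists_eq_mul_of_ker_le (f := S.proj) (g := f) (by rw [hf, S.ker_proj])
  -- Left multiplication identifies `λ`-related elements, so after inserting `S'.proj` on the left,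
  -- `g` may be replaced by `f`, and `S.proj` by `S'.proj`.
  have h1 : g * u = S'.proj := by
    rw [← S'.proj_mul (f := g) hg.ge, ← lam_mul_left hl, mul_assoc, ← hu,
      lam_mul_left (S.lam_proj S'), S'.proj_mul S'.ker_proj.ge]
  rw [hu, ← h1]
  exact σ.mul h (σ.refl u)

theorem PartitionOver.le_restrict {X : Type*} {r : ℕ} {A : IdempotentMap X r}
    {I J : Setoid (Fin r)} (h : I ≤ J) (S : A.PartitionOver I) : S.1 ≤ (S.restrict h).1 := by
  intro x y hxy
  obtain ⟨i, hi⟩ := S.2.1 y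
  exact ⟨i, i, S.1.trans hxy hi, hi, J.refl i⟩

/-- The `𝒫`-system of a congruence. -/
noncomputable def PSystem.ofCon {X : Type*} {r : ℕ} {A : IdempotentMap X r} (σ : Con A.P) :
    A.PSystem where
  rel I := σ.toSetoid.comap fun S => S.proj
  restrict_rel I J h S S' hS := by
    change σ (S.restrict h).proj (S'.restrict h).proj
    have h1 := S.proj_mul (f := (S.restrict h).proj) (by rw [PartitionOver.ker_proj]; exact S.le_restrict h)
    have h2 := S'.proj_mul (f := (S'.restrict h).proj) (by rw [PartitionOver.ker_proj]; exact S'.le_restrict h)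
    rw [← h1, ← h2, ← lam_mul_left ((S.restrict h).lam_proj (S'.restrict h))]
    exact σ.mul hS (σ.refl _)

/-- Right multiplication by `f` turns `S.proj` into `f` and `S'.proj` into `g`, the latter because
`S'.proj * f = S'.proj * g`. So relating representatives and relating the elements themselves amount
to the same. -/
theorem PSystem.lamRel_ofCon {X : Type*} {r : ℕ} {A : IdempotentMap X r} (σ : Con A.P)
    (f g : A.P) : (PSystem.ofCon σ).lamRel f g ↔ lam f g ∧ σ f g := by
  constructor
  · rintro ⟨I, S, S', h, hl, hf, hg⟩
    refine ⟨hl, ?_⟩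
    have h' : σ S.proj S'.proj := h
    rw [← S.proj_mul (f := f) hf.ge, ← S'.proj_mul (f := g) hg.ge, ← lam_mul_left hl]
    exact σ.mul h' (σ.refl f)
  · rintro ⟨hl, h⟩
    obtain ⟨I, S, hf⟩ := A.exists_partitionOver f
    obtain ⟨I', S', hg⟩ := A.exists_partitionOver g
    have hI : I = I' := by
      ext i j
      rw [← S.2.2, ← S'.2.2, ← hf, ← hg, ← A.a_pt i, ← A.a_pt j]
      change f.fn _ = f.fn _ ↔ g.fn _ = g.fn _
      rw [lam_iff.1 hl, lam_iff.1 hl]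
    subst hI
    exact ⟨I, S, S', PartitionOver.proj_rel h hl hf hg, hl, hf, hg⟩

/-- A `𝒫`-system can be read off its congruence at the representatives; this is the source of
uniqueness for `Ψ₁`. -/
theorem PSystem.rel_iff {X : Type*} {r : ℕ} {A : IdempotentMap X r} (Ψ : A.PSystem)
    {I : Setoid (Fin r)} (S S' : A.PartitionOver I) :
    Ψ.rel I S S' ↔ Ψ.lamRel S.proj S'.proj := by
  constructor
  · intro h
    exact ⟨I, S, S', h, S.lam_proj S', S.ker_proj, S'.ker_proj⟩
  · rintro ⟨J, T, T', h, -, h1, h2⟩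
    rw [S.ker_proj] at h1
    rw [S'.ker_proj] at h2
    obtain rfl := S.index_eq T h1
    obtain rfl : S = T := Subtype.ext h1
    obtain rfl : S' = T' := Subtype.ext h2
    exact h

theorem PSystem.le_rank_iff {X : Type*} {r : ℕ} {A : IdempotentMap X r} (Ψ : A.PSystem)
    {k : ℕ} (hk : k ≤ r) :
    k ≤ Ψ.rank ↔ ∀ I : Setoid (Fin r), Nat.card (Quotient I) ≤ k → Ψ.rel I = ⊤ := by
  have hb : BddAbove {q : ℕ | q ≤ r ∧ ∀ I : Setoid (Fin r), Nat.card (Quotient I) ≤ q →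
    Ψ.rel I = ⊤} := ⟨r, fun q h => h.1⟩
  constructor
  · intro h I hI
    -- Zero always qualifies, so the supremum is attained. A partition with no blocks means `[r]` is
    -- empty; then `X` is empty too and there is only one partition of it.
    have h0 : 0 ∈ {q : ℕ | q ≤ r ∧ ∀ I : Setoid (Fin r), Nat.card (Quotient I) ≤ q →
        Ψ.rel I = ⊤} := by
      refine ⟨Nat.zero_le _, fun J hJ => ?_⟩
      have : IsEmpty (Quotient J) := by
        rw [← not_nonempty_iff]
        intro h
        have := Nat.card_pos (α := Quotient J)
        omega
      ext S S'
      refine ⟨fun _ => trivial, fun _ => ?_⟩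
      have hS : S = S' := by
        apply Subtype.ext
        ext x
        obtain ⟨i, -⟩ := S.2.1 x
        exact (this.false (Quotient.mk J i)).elim
      rw [hS]
    exact (Nat.sSup_mem ⟨0, h0⟩ hb).2 I (hI.trans h)
  · intro h
    exact le_csSup hb ⟨hk, h⟩

/-! ### Representatives of `𝓛`-classes -/

/-- A retraction of `[r]` onto `I`. -/
noncomputable def retract {r : ℕ} {I : Finset (Fin r)} (hI : I.Nonempty) (i : Fin r) : Fin r :=
  if i ∈ I then i else hI.choose

theorem retract_mem {r : ℕ} {I : Finset (Fin r)} (hI : I.Nonempty) (i : Fin r) :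
    retract hI i ∈ I := by
  rw [retract]
  split_ifs with h
  · exact h
  · exact hI.choose_spec

theorem retract_of_mem {r : ℕ} {I : Finset (Fin r)} (hI : I.Nonempty) {i : Fin r} (h : i ∈ I) :
    retract hI i = i := if_pos h

theorem CrossSection.exists_mem {X : Type*} {r : ℕ} {A : IdempotentMap X r}
    {I : Finset (Fin r)} (C : A.CrossSection I) {i : Fin r} (hi : i ∈ I) :
    ∃ y, y ∈ C.1 ∧ A.a y = A.pt i := by
  obtain ⟨y, h1, h2⟩ := (C.mem_iff i).1 hi
  exact ⟨y, h1, h2⟩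

theorem CrossSection.eq_of_a_eq {X : Type*} {r : ℕ} {A : IdempotentMap X r}
    {I : Finset (Fin r)} (C : A.CrossSection I) {x y : X} (hx : x ∈ C.1) (hy : y ∈ C.1)
    (h : A.a x = A.a y) : x = y := by
  obtain ⟨c, hc, hC⟩ := C.2
  rw [hC] at hx hy
  obtain ⟨i, hi, rfl⟩ := hx
  obtain ⟨j, hj, rfl⟩ := hy
  rw [show A.a (c i) = A.pt i from hc i hi, show A.a (c j) = A.pt j from hc j hj] at h
  rw [A.pt_injective h]

theorem CrossSection.exists_index {X : Type*} {r : ℕ} {A : IdempotentMap X r}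
    {I : Finset (Fin r)} (C : A.CrossSection I) {x : X} (hx : x ∈ C.1) :
    ∃ i ∈ I, A.a x = A.pt i := by
  obtain ⟨c, hc, hC⟩ := C.2
  rw [hC] at hx
  obtain ⟨i, hi, rfl⟩ := hx
  exact ⟨i, hi, hc i hi⟩

/-- The element of `P` that maps `A_i`, for `i ∈ I`, to the element of the cross-section `C` in `A_i`,
and the other `A_i` to a fixed element of `C`. -/
noncomputable def CrossSection.sect {X : Type*} {r : ℕ} {A : IdempotentMap X r}
    {I : Finset (Fin r)} (C : A.CrossSection I) (hI : I.Nonempty) : A.P :=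
  ⟨fun x => (C.exists_mem (retract_mem hI (A.exists_pt x).choose)).choose, mem_regPart_of
    (fun x y h => C.eq_of_a_eq (C.exists_mem (retract_mem hI _)).choose_spec.1
      (C.exists_mem (retract_mem hI _)).choose_spec.1 h)
    (fun x => ⟨x, by simp only [A.idem]⟩)⟩

theorem CrossSection.sect_mem {X : Type*} {r : ℕ} {A : IdempotentMap X r}
    {I : Finset (Fin r)} (C : A.CrossSection I) (hI : I.Nonempty) (x : X) :
    (C.sect hI).fn x ∈ C.1 :=
  (C.exists_mem (retract_mem hI (A.exists_pt x).choose)).choose_spec.1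

theorem CrossSection.a_sect {X : Type*} {r : ℕ} {A : IdempotentMap X r}
    {I : Finset (Fin r)} (C : A.CrossSection I) (hI : I.Nonempty) {x : X} {i : Fin r}
    (h : A.a x = A.pt i) : A.a ((C.sect hI).fn x) = A.pt (retract hI i) := by
  have h1 : (A.exists_pt x).choose = i :=
    A.pt_injective ((A.exists_pt x).choose_spec.symm.trans h)
  rw [← h1]
  exact (C.exists_mem (retract_mem hI (A.exists_pt x).choose)).choose_spec.2

/-- `sect` returns each point of `C` to itself, because `C` has at most one point in each `a`-block
and `retract` is the identity on `I`. -/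
theorem CrossSection.mul_sect {X : Type*} {r : ℕ} {A : IdempotentMap X r}
    {I : Finset (Fin r)} (C : A.CrossSection I) (hI : I.Nonempty) {f : A.P} (h : f.im ⊆ C.1) :
    f * C.sect hI = f := by
  ext x
  have hx : f.fn x ∈ C.1 := h ⟨x, rfl⟩
  apply C.eq_of_a_eq (C.sect_mem hI _) hx
  obtain ⟨i, hi, hxi⟩ := C.exists_index hx
  have h1 := C.a_sect hI (x := A.a (f.fn x)) (i := i) (by rw [A.idem, hxi])
  rw [retract_of_mem hI hi, ← hxi] at h1
  exact h1

theorem CrossSection.im_sect {X : Type*} {r : ℕ} {A : IdempotentMap X r}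
    {I : Finset (Fin r)} (C : A.CrossSection I) (hI : I.Nonempty) : (C.sect hI).im = C.1 := by
  apply Set.Subset.antisymm
  · rintro _ ⟨x, rfl⟩
    exact C.sect_mem hI x
  · intro y hy
    refine ⟨y, C.eq_of_a_eq (C.sect_mem hI _) hy ?_⟩
    obtain ⟨i, hi, hyi⟩ := C.exists_index hy
    rw [C.a_sect hI hyi, retract_of_mem hI hi, hyi]

theorem CrossSection.rho_sect {X : Type*} {r : ℕ} {A : IdempotentMap X r}
    {I : Finset (Fin r)} (C C' : A.CrossSection I) (hI : I.Nonempty) :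
    rho (C.sect hI) (C'.sect hI) := by
  rw [rho_iff]
  intro x
  obtain ⟨i, hi⟩ := A.exists_pt x
  rw [C.a_sect hI hi, C'.a_sect hI hi]

theorem CrossSection.rank_sect {X : Type*} {r : ℕ} {A : IdempotentMap X r}
    {I : Finset (Fin r)} (C : A.CrossSection I) (hI : I.Nonempty) :
    (C.sect hI).rank = I.card := by
  rw [rank, C.im_sect]
  obtain ⟨c, hc, hC⟩ := C.2
  rw [hC, Set.InjOn.ncard_image, Set.ncard_coe_finset]
  intro i hi j hj h
  exact A.pt_injective ((hc i hi).symm.trans ((congrArg A.a h).trans (hc j hj)))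

/-- A congruence relating two `ρ`-related elements relates the representatives of their
`𝓛`-classes. -/
theorem CrossSection.sect_rel {X : Type*} {r : ℕ} {A : IdempotentMap X r}
    {I : Finset (Fin r)} {C C' : A.CrossSection I} (hI : I.Nonempty) {σ : Con A.P} {f g : A.P}
    (h : σ f g) (hl : rho f g) (hf : f.im = C.1) (hg : g.im = C'.1) :
    σ (C.sect hI) (C'.sect hI) := by
  obtain ⟨u, hu⟩ := exists_eq_mul_of_im_subset (f := C.sect hI) (g := f) (by rw [hf, C.im_sect])
  have h1 : u * g = C'.sect hI := by
    rw [← C'.mul_sect hI (f := g) hg.le, ← rho_mul_right hl, ← mul_assoc, ← hu,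
      rho_mul_right (C.rho_sect C' hI), C'.mul_sect hI (C'.im_sect hI).le]
  rw [hu, ← h1]
  exact σ.mul (σ.refl u) h

/-- The `𝒞`-system of a congruence. -/
noncomputable def CSystem.ofCon {X : Type*} {r : ℕ} {A : IdempotentMap X r} (σ : Con A.P) :
    A.CSystem where
  rel I hI := σ.toSetoid.comap fun C => C.sect hI
  restrict_rel I J hI hJ h C C' hC := by
    change σ ((C.restrict h).sect hJ) ((C'.restrict h).sect hJ)
    have h1 := C.mul_sect hI (f := (C.restrict h).sect hJ)
      (by rw [CrossSection.im_sect]; exact fun _ h => h.1)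
    have h2 := C'.mul_sect hI (f := (C'.restrict h).sect hJ)
      (by rw [CrossSection.im_sect]; exact fun _ h => h.1)
    rw [← h1, ← h2, ← rho_mul_right ((C.restrict h).rho_sect (C'.restrict h) hJ)]
    exact σ.mul (σ.refl _) hC

theorem CSystem.rhoRel_ofCon {X : Type*} [Nonempty X] {r : ℕ} {A : IdempotentMap X r}
    (σ : Con A.P) (f g : A.P) : (CSystem.ofCon σ).rhoRel f g ↔ rho f g ∧ σ f g := by
  constructor
  · rintro ⟨I, hI, C, C', h, hl, hf, hg⟩
    refine ⟨hl, ?_⟩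
    have h' : σ (C.sect hI) (C'.sect hI) := h
    rw [← C.mul_sect hI (f := f) hf.le, ← C'.mul_sect hI (f := g) hg.le, ← rho_mul_right hl]
    exact σ.mul (σ.refl f) h'
  · rintro ⟨hl, h⟩
    obtain ⟨I, hI, C, hf⟩ := A.exists_crossSection f
    obtain ⟨I', hI', C', hg⟩ := A.exists_crossSection g
    have hII : I = I' := by
      ext i
      rw [C.mem_iff, C'.mem_iff, ← hf, ← hg]
      constructor
      · rintro ⟨_, ⟨x, rfl⟩, hx⟩
        exact ⟨_, ⟨x, rfl⟩, (rho_iff.1 hl x).symm.trans hx⟩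
      · rintro ⟨_, ⟨x, rfl⟩, hx⟩
        exact ⟨_, ⟨x, rfl⟩, (rho_iff.1 hl x).trans hx⟩
    subst hII
    exact ⟨I, hI, C, C', CrossSection.sect_rel hI h hl hf hg, hl, hf, hg⟩

theorem CSystem.rel_iff {X : Type*} {r : ℕ} {A : IdempotentMap X r} (Ψ : A.CSystem)
    {I : Finset (Fin r)} (hI : I.Nonempty) (C C' : A.CrossSection I) :
    Ψ.rel I hI C C' ↔ Ψ.rhoRel (C.sect hI) (C'.sect hI) := by
  constructor
  · intro h
    exact ⟨I, hI, C, C', h, C.rho_sect C' hI, C.im_sect hI, C'.im_sect hI⟩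
  · rintro ⟨J, hJ, D, D', h, -, h1, h2⟩
    rw [C.im_sect] at h1
    rw [C'.im_sect] at h2
    obtain rfl := C.index_eq D h1
    obtain rfl : C = D := Subtype.ext h1
    obtain rfl : C' = D' := Subtype.ext h2
    exact h

theorem CSystem.le_rank_iff {X : Type*} {r : ℕ} {A : IdempotentMap X r} (Ψ : A.CSystem)
    {k : ℕ} (hk : k ≤ r) :
    k ≤ Ψ.rank ↔ ∀ (I : Finset (Fin r)) (hI : I.Nonempty), I.card ≤ k → Ψ.rel I hI = ⊤ := by
  have hb : BddAbove {q : ℕ | q ≤ r ∧ ∀ (I : Finset (Fin r)) (hI : I.Nonempty), I.card ≤ q →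
    Ψ.rel I hI = ⊤} := ⟨r, fun q h => h.1⟩
  constructor
  · intro h I hI hc
    have h0 : 0 ∈ {q : ℕ | q ≤ r ∧ ∀ (I : Finset (Fin r)) (hI : I.Nonempty), I.card ≤ q →
        Ψ.rel I hI = ⊤} :=
      ⟨Nat.zero_le _, fun J hJ hc => absurd hJ.card_pos (by omega)⟩
    exact (Nat.sSup_mem ⟨0, h0⟩ hb).2 I hI (hc.trans h)
  · intro h
    exact le_csSup hb ⟨hk, h⟩

end IdempotentMap

namespace IdempotentMap

open RegVariant

/-! ### Commutation -/

/-- Write `h = u y v` and `f = u x v`, and cancel `v` by `w`. Then `m = w (y⁻¹ x) v` and `n = w v`,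
with the identity of `S_q` in the middle, work. The point is that `m` and `n` can be applied to any
other `g`, carrying the `ν`-pair to an `R_N`-pair. -/
theorem SymIdentification.exists_mul_right {X : Type*} [Finite X] {r : ℕ}
    {A : IdempotentMap X r} {q : ℕ} (E : A.SymIdentification q)
    {N : Subgroup (Equiv.Perm (Fin q))} {f h : A.P} (hn : E.nu N f h) :
    ∃ m n : A.P, f = h * m ∧ h = h * n ∧ ∀ g, E.RRel N (g * m) (g * n) := by
  obtain ⟨hf, hh, u, v, x, y, hx, hy, h1, h2⟩ := hn
  obtain ⟨-, w, hw⟩ := E.cancel hh h2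
  have hz : ∀ z, ∃ m : A.P, (m : WithOne A.P) = w * E.ι z * v := fun z => by
    obtain ⟨k, hk⟩ := exists_coe_eq_mul w (E.ι z)
    obtain ⟨m, hm⟩ := exists_coe_eq_mul' v k
    exact ⟨m, by rw [hm, hk]⟩
  have key : ∀ z, (h : WithOne A.P) * (w * E.ι z * v) = u * E.ι (y * z) * v := fun z => by
    calc (h : WithOne A.P) * (w * E.ι z * v) = u * (E.ι y * E.ι 1) * v * (w * E.ι z * v) := by
          rw [h2, E.mul_one']
      _ = u * E.ι y * (E.ι 1 * v * w) * E.ι z * v := by simp only [mul_assoc]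
      _ = u * ((E.ι y * E.ι 1) * E.ι z) * v := by rw [hw]; simp only [mul_assoc]
      _ = _ := by rw [E.mul_one', E.coe_mul]
  obtain ⟨m, hm⟩ := hz (y⁻¹ * x)
  obtain ⟨n, hn⟩ := hz 1
  refine ⟨m, n, ?_, ?_, fun g => ?_⟩
  · apply WithOne.coe_injective
    rw [WithOne.coe_mul, hm, key, mul_inv_cancel_left, h1]
  · apply WithOne.coe_injective
    rw [WithOne.coe_mul, hn, key, mul_one, h2]
  · exact E.RRel_of_eq_mul (u := g * w) (v := v) (N.mul_mem (N.inv_mem hy) hx) N.one_mem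
      (by rw [WithOne.coe_mul, hm]; simp only [mul_assoc])
      (by rw [WithOne.coe_mul, hn]; simp only [mul_assoc])

theorem SymIdentification.exists_mul_left {X : Type*} [Finite X] {r : ℕ}
    {A : IdempotentMap X r} {q : ℕ} (E : A.SymIdentification q)
    {N : Subgroup (Equiv.Perm (Fin q))} {f h : A.P} (hn : E.nu N f h) :
    ∃ m n : A.P, f = m * h ∧ h = n * h ∧ ∀ g, E.RRel N (m * g) (n * g) := by
  obtain ⟨hf, hh, u, v, x, y, hx, hy, h1, h2⟩ := hn
  obtain ⟨⟨p, hp⟩, -⟩ := E.cancel hh h2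
  have hz : ∀ z, ∃ m : A.P, (m : WithOne A.P) = u * E.ι z * p := fun z => by
    obtain ⟨k, hk⟩ := exists_coe_eq_mul u (E.ι z)
    obtain ⟨m, hm⟩ := exists_coe_eq_mul' p k
    exact ⟨m, by rw [hm, hk]⟩
  have key : ∀ z, (u * E.ι z * p : WithOne A.P) * h = u * E.ι (z * y) * v := fun z => by
    calc (u * E.ι z * p : WithOne A.P) * h = u * E.ι z * p * (u * (E.ι 1 * E.ι y) * v) := by
          rw [h2, E.one_mul']
      _ = u * E.ι z * (p * u * E.ι 1) * E.ι y * v := by simp only [mul_assoc]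
      _ = u * ((E.ι z * E.ι 1) * E.ι y) * v := by rw [hp]; simp only [mul_assoc]
      _ = _ := by rw [E.mul_one', E.coe_mul]
  obtain ⟨m, hm⟩ := hz (x * y⁻¹)
  obtain ⟨n, hn⟩ := hz 1
  refine ⟨m, n, ?_, ?_, fun g => ?_⟩
  · apply WithOne.coe_injective
    rw [WithOne.coe_mul, hm, key, inv_mul_cancel_right, h1]
  · apply WithOne.coe_injective
    rw [WithOne.coe_mul, hn, key, one_mul, h2]
  · exact E.RRel_of_eq_mul (u := u) (v := p * g) (N.mul_mem hx (N.inv_mem hy)) N.one_mem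
      (by rw [WithOne.coe_mul, hm]; simp only [mul_assoc])
      (by rw [WithOne.coe_mul, hn]; simp only [mul_assoc])

theorem PSystem.lam_of_lamRel {X : Type*} {r : ℕ} {A : IdempotentMap X r} {Ψ : A.PSystem}
    {f g : A.P} (h : Ψ.lamRel f g) : lam f g := by
  obtain ⟨_, _, _, _, h, _⟩ := h
  exact h

theorem CSystem.rho_of_rhoRel {X : Type*} {r : ℕ} {A : IdempotentMap X r} {Ψ : A.CSystem}
    {f g : A.P} (h : Ψ.rhoRel f g) : rho f g := by
  obtain ⟨_, _, _, _, _, h, _⟩ := h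
  exact h

/-- For a `ν`-pair `f = h * m`, `h = h * n`, the new middle element is `g * m`. Since `g` is a left
multiple of `h`, also `g * n = g`. Pairs of small rank stay small because `κ` preserves rank. -/
theorem SymIdentification.RCon_lamCon_commute {X : Type*} [Finite X] {r : ℕ}
    {A : IdempotentMap X r} {q : ℕ} (E : A.SymIdentification q)
    {N : Subgroup (Equiv.Perm (Fin q))} (hN : N.Normal) (Ψ : A.PSystem) (f h g : A.P)
    (h1 : E.RCon N hN f h) (h2 : Ψ.lamCon h g) :
    ∃ k, Ψ.lamCon f k ∧ E.RCon N hN k g := by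
  have hl : lam h g := Ψ.lam_of_lamRel h2
  rcases h1 with ⟨h3, h4⟩ | h3 | rfl
  · exact ⟨f, Ψ.lamCon.refl f, Or.inl ⟨h3, by rwa [← rank_eq_of_kappa hl.1]⟩⟩
  · obtain ⟨m, n, hm, hn, hR⟩ := E.exists_mul_right h3
    refine ⟨g * m, ?_, ?_⟩
    · rw [hm]
      exact Ψ.lamCon.mul h2 (Ψ.lamCon.refl m)
    · obtain ⟨c, hc⟩ := exists_eq_mul_of_im_subset hl.im_eq.ge
      have h4 := hR g
      have h5 : g * n = g := by
        conv_lhs => rw [hc, mul_assoc, ← hn]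
        exact hc.symm
      rwa [h5] at h4
  · exact ⟨g, h2, (E.RCon N hN).refl g⟩

theorem SymIdentification.RCon_rhoCon_commute {X : Type*} [Finite X] [Nonempty X] {r : ℕ}
    {A : IdempotentMap X r} {q : ℕ} (E : A.SymIdentification q)
    {N : Subgroup (Equiv.Perm (Fin q))} (hN : N.Normal) (Ψ : A.CSystem) (f h g : A.P)
    (h1 : E.RCon N hN f h) (h2 : Ψ.rhoCon h g) :
    ∃ k, Ψ.rhoCon f k ∧ E.RCon N hN k g := by
  have hl : rho h g := Ψ.rho_of_rhoRel h2
  rcases h1 with ⟨h3, h4⟩ | h3 | rfl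
  · exact ⟨f, Ψ.rhoCon.refl f, Or.inl ⟨h3, by rwa [← rank_eq_of_kappa hl.1]⟩⟩
  · obtain ⟨m, n, hm, hn, hR⟩ := E.exists_mul_left h3
    refine ⟨m * g, ?_, ?_⟩
    · rw [hm]
      exact Ψ.rhoCon.mul (Ψ.rhoCon.refl m) h2
    · obtain ⟨c, hc⟩ := exists_eq_mul_of_ker_le hl.ker_eq.le
      have h4 := hR g
      have h5 : n * g = g := by
        conv_lhs => rw [hc, ← mul_assoc, ← hn]
        exact hc.symm
      rwa [h5] at h4
  · exact ⟨g, h2, (E.RCon N hN).refl g⟩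

/-- The ends are `κ`-related, so there is an element with the kernel of `f` and the image of `g`. As
`λ` keeps images and `ρ` keeps kernels, the same pairs of partitions and of cross-sections serve in
the opposite order. -/
theorem PSystem.lamCon_rhoCon_commute {X : Type*} [Nonempty X] {r : ℕ}
    {A : IdempotentMap X r} (Ψ₁ : A.PSystem) (Ψ₂ : A.CSystem) (f h g : A.P)
    (h1 : Ψ₁.lamCon f h) (h2 : Ψ₂.rhoCon h g) :
    ∃ k, Ψ₂.rhoCon f k ∧ Ψ₁.lamCon k g := by
  obtain ⟨I, S, S', h3, hl, hf, hh⟩ := h1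
  obtain ⟨J, hJ, C, C', h4, hr, hh', hg⟩ := h2
  obtain ⟨k, hk1, hk2, -⟩ := exists_rho_lam (hl.1.trans hr.1)
  exact ⟨k, ⟨J, hJ, C, C', h4, hk1, hl.im_eq.trans hh', hk2.im_eq.trans hg⟩,
    ⟨I, S, S', h3, hk2, hk1.ker_eq.symm.trans hf, hr.ker_eq.symm.trans hh⟩⟩

/-- The join of `R_N`, `λ(Ψ₁)` and `ρ(Ψ₂)` is their composite. -/
theorem SymIdentification.sup_iff {X : Type*} [Finite X] [Nonempty X] {r : ℕ}
    {A : IdempotentMap X r} {q : ℕ} (E : A.SymIdentification q)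
    {N : Subgroup (Equiv.Perm (Fin q))} (hN : N.Normal) (Ψ₁ : A.PSystem) (Ψ₂ : A.CSystem)
    (f g : A.P) : (E.RCon N hN ⊔ Ψ₁.lamCon ⊔ Ψ₂.rhoCon) f g ↔
      ∃ h k, E.RRel N f h ∧ Ψ₁.lamRel h k ∧ Ψ₂.rhoRel k g := by
  have h1 := Con.sup_iff_of_commute (E.RCon_lamCon_commute hN Ψ₁)
  rw [Con.sup_iff_of_commute]
  · constructor
    · rintro ⟨k, h2, h3⟩
      obtain ⟨h, h4, h5⟩ := (h1 _ _).1 h2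
      exact ⟨h, k, h4, h5, h3⟩
    · rintro ⟨h, k, h4, h5, h3⟩
      exact ⟨k, (h1 _ _).2 ⟨h, h4, h5⟩, h3⟩
  · intro x y z h2 h3
    obtain ⟨t, h4, h5⟩ := (h1 _ _).1 h2
    obtain ⟨s, h6, h7⟩ := Ψ₁.lamCon_rhoCon_commute Ψ₂ _ _ _ h5 h3
    obtain ⟨w, h8, h9⟩ := E.RCon_rhoCon_commute hN Ψ₂ _ _ _ h4 h6
    exact ⟨w, h8, (h1 _ _).2 ⟨s, h9, h7⟩⟩

/-! ### Recovering the data from the join -/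

theorem SymIdentification.RRel_greenH {X : Type*} [Finite X] {r : ℕ}
    {A : IdempotentMap X r} {q : ℕ} (E : A.SymIdentification q)
    {N : Subgroup (Equiv.Perm (Fin q))} {f g : A.P} (h : E.RRel N f g) (hf : q ≤ f.rank) :
    f.im = g.im ∧ f.ker = g.ker := by
  rcases h with ⟨h, -⟩ | h | rfl
  · omega
  · rw [← greenL_iff, ← greenR_iff]
    obtain ⟨m, -, hm, -⟩ := E.exists_mul_right h
    obtain ⟨m', -, hm', -⟩ := E.exists_mul_right (E.nu_symm h)
    obtain ⟨n, -, hn, -⟩ := E.exists_mul_left h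
    obtain ⟨n', -, hn', -⟩ := E.exists_mul_left (E.nu_symm h)
    refine ⟨⟨⟨n, ?_⟩, ⟨n', ?_⟩⟩, ⟨⟨m, ?_⟩, ⟨m', ?_⟩⟩⟩ <;> rw [← WithOne.coe_mul, WithOne.coe_inj] <;>
      assumption
  · exact ⟨rfl, rfl⟩

/-- If `x = u y v` and `1 = u z v` in `P`, compressing `u` and `v` by the group identity gives `s, t
∈ S_q` with `x = s y t` and `1 = s z t`. So `x` is the conjugate of `y z⁻¹` by `s`. -/
theorem SymIdentification.RRel_iff_mem {X : Type*} [Finite X] {r : ℕ}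
    {A : IdempotentMap X r} {q : ℕ} (E : A.SymIdentification q)
    {N : Subgroup (Equiv.Perm (Fin q))} (hN : N.Normal) (x : Equiv.Perm (Fin q)) :
    E.RRel N (E.ι x) (E.ι 1) ↔ x ∈ N := by
  constructor
  · rintro (⟨h, -⟩ | ⟨hf, hg, u, v, y, z, hy, hz, h1, h2⟩ | h)
    · rw [E.rank_eq] at h
      exact absurd h (lt_irrefl _)
    · obtain ⟨⟨p, hp⟩, ⟨w, hw⟩⟩ := E.cancel hg h2
      have hs : ∃ s, (E.ι 1 : WithOne A.P) * u * E.ι 1 = (E.ι s : A.P) := by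
        obtain ⟨k, hk⟩ := exists_coe_eq_mul u (E.ι 1)
        refine E.mem_of_rank (t := k) ?_ ⟨1, E.ι z * v, ?_⟩
        · rw [hk]
          simp only [mul_assoc]
          rw [← WithOne.coe_mul, ← map_mul, one_mul]
        · calc ((E.ι 1 : A.P) : WithOne A.P) = E.ι 1 * E.ι 1 := (E.one_mul' 1).symm
            _ = E.ι 1 * (u * (E.ι 1 * E.ι z) * v) := by rw [E.one_mul' z, ← h2]
            _ = _ := by simp only [mul_assoc, one_mul]
      have ht : ∃ t, (E.ι 1 : WithOne A.P) * v * E.ι 1 = (E.ι t : A.P) := by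
        obtain ⟨k, hk⟩ := exists_coe_eq_mul v (E.ι 1)
        refine E.mem_of_rank (t := k) ?_ ⟨u * E.ι z, 1, ?_⟩
        · rw [hk]
          simp only [mul_assoc]
          rw [← WithOne.coe_mul, ← map_mul, one_mul]
        · calc ((E.ι 1 : A.P) : WithOne A.P) = E.ι 1 * E.ι 1 := (E.one_mul' 1).symm
            _ = (u * (E.ι z * E.ι 1) * v) * E.ι 1 := by rw [E.mul_one' z, ← h2]
            _ = _ := by simp only [mul_assoc, mul_one]
      obtain ⟨s, hs⟩ := hs
      obtain ⟨t, ht⟩ := ht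
      have key : ∀ f z, ((E.ι f : A.P) : WithOne A.P) = u * E.ι z * v → f = s * z * t := by
        intro f z h
        apply E.injective
        apply WithOne.coe_injective
        rw [E.coe_mul, E.coe_mul, ← hs, ← ht]
        calc ((E.ι f : A.P) : WithOne A.P) = E.ι 1 * E.ι f * E.ι 1 := by
              rw [E.one_mul', E.mul_one']
          _ = E.ι 1 * (u * ((E.ι 1 * E.ι z) * E.ι 1) * v) * E.ι 1 := by
              rw [E.one_mul' z, E.mul_one' z, h]
          _ = _ := by simp only [mul_assoc]
      have h3 := key _ _ h1
      have h4 := key _ _ h2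
      have : x = s * (y * z⁻¹) * s⁻¹ := by
        have ht' : t = z⁻¹ * s⁻¹ := by
          rw [← mul_inv_rev, eq_comm, inv_eq_iff_mul_eq_one]
          exact h4.symm
        rw [h3, ht']
        group
      rw [this]
      exact hN.conj_mem _ (N.mul_mem hy (N.inv_mem hz)) s
    · rw [E.injective h]
      exact N.one_mem
  · intro hx
    refine Or.inr (Or.inl ⟨E.rank_eq x, E.rank_eq 1, 1, 1, x, 1, hx, N.one_mem, ?_, ?_⟩) <;>
      rw [one_mul, mul_one]

section Uniqueness

variable {X : Type*} [Finite X] {r : ℕ} {A : IdempotentMap X r} {q : ℕ}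
  {E : A.SymIdentification q} {N : Subgroup (Equiv.Perm (Fin q))} {Ψ₁ : A.PSystem}
  {Ψ₂ : A.CSystem} {f g h k : A.P}

/-- All of `f, h, k, g` have one image, so the `ρ`-step is trivial; then `f` and `h` are `λ`-related
with equal kernels, so the `R_N`-step is trivial too. The next two lemmas isolate the other factors
in the same way. -/
theorem lamRel_of_comp (h1 : E.RRel N f h) (h2 : Ψ₁.lamRel h k) (h3 : Ψ₂.rhoRel k g)
    (hf : q ≤ f.rank) (hfg : lam f g) : Ψ₁.lamRel f g := by
  obtain ⟨hi, hk⟩ := E.RRel_greenH h1 hf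
  have hl := PSystem.lam_of_lamRel h2
  obtain rfl := eq_of_rho_of_im (CSystem.rho_of_rhoRel h3)
    (hl.im_eq.symm.trans (hi.symm.trans hfg.im_eq))
  obtain rfl := eq_of_lam_of_ker (hfg.trans hl.symm) hk
  exact h2

theorem rhoRel_of_comp (h1 : E.RRel N f h) (h2 : Ψ₁.lamRel h k) (h3 : Ψ₂.rhoRel k g)
    (hf : q ≤ f.rank) (hfg : rho f g) : Ψ₂.rhoRel f g := by
  obtain ⟨hi, hk⟩ := E.RRel_greenH h1 hf
  have hr := CSystem.rho_of_rhoRel h3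
  obtain rfl := eq_of_lam_of_ker (PSystem.lam_of_lamRel h2)
    (hk.symm.trans (hfg.ker_eq.trans hr.ker_eq.symm))
  obtain rfl := eq_of_rho_of_im (hfg.trans hr.symm) hi
  exact h3

theorem RRel_of_comp (h1 : E.RRel N f h) (h2 : Ψ₁.lamRel h k) (h3 : Ψ₂.rhoRel k g)
    (hf : q ≤ f.rank) (him : f.im = g.im) (hker : f.ker = g.ker) : E.RRel N f g := by
  obtain ⟨hi, hk⟩ := E.RRel_greenH h1 hf
  have hl := PSystem.lam_of_lamRel h2
  have hr := CSystem.rho_of_rhoRel h3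
  obtain rfl := eq_of_lam_of_ker hl (hk.symm.trans (hker.trans hr.ker_eq.symm))
  obtain rfl := eq_of_rho_of_im hr (hi.symm.trans him)
  exact h1

end Uniqueness

end IdempotentMap

namespace IdempotentMap

open RegVariant

/-! ### The normal subgroup of a congruence -/

/-- The subgroup of all `x ∈ S_q` that the congruence `σ` identifies with `1`. -/
def SymIdentification.conSubgroup {X : Type*} {r : ℕ} {A : IdempotentMap X r} {q : ℕ}
    (E : A.SymIdentification q) (σ : Con A.P) : Subgroup (Equiv.Perm (Fin q)) where
  carrier := {x | σ (E.ι x) (E.ι 1)}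
  one_mem' := σ.refl _
  mul_mem' := by
    intro x y hx hy
    have := σ.mul hx hy
    rwa [← map_mul, ← map_mul, one_mul] at this
  inv_mem' := by
    intro x hx
    have := σ.mul (σ.refl (E.ι x⁻¹)) hx
    rw [← map_mul, ← map_mul, mul_one, inv_mul_cancel] at this
    exact σ.symm this

theorem SymIdentification.conSubgroup_normal {X : Type*} {r : ℕ} {A : IdempotentMap X r} {q : ℕ}
    (E : A.SymIdentification q) (σ : Con A.P) : (E.conSubgroup σ).Normal := by
  refine ⟨fun x hx g => ?_⟩
  have := σ.mul (σ.mul (σ.refl (E.ι g)) hx) (σ.refl (E.ι g⁻¹))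
  rw [← map_mul, ← map_mul, ← map_mul, ← map_mul, mul_one, mul_inv_cancel] at this
  exact this

theorem SymIdentification.RCon_conSubgroup_le {X : Type*} [Finite X] {r : ℕ}
    {A : IdempotentMap X r} {q : ℕ} (E : A.SymIdentification q) {σ : Con A.P}
    (hσ : ∀ f g : A.P, f.rank < q → g.rank < q → σ f g) {f g : A.P}
    (h : E.RRel (E.conSubgroup σ) f g) : σ f g := by
  rcases h with ⟨h1, h2⟩ | ⟨-, -, u, v, x, y, hx, hy, h1, h2⟩ | rfl
  · exact hσ f g h1 h2
  · obtain ⟨k, hk⟩ := exists_coe_eq_mul u (E.ι 1)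
    obtain ⟨l, hl⟩ := exists_coe_eq_mul' v (E.ι 1)
    have key : ∀ z, u * E.ι z * v = ((k * E.ι z * l : A.P) : WithOne A.P) := fun z => by
      rw [WithOne.coe_mul, WithOne.coe_mul, hk, hl]
      calc u * E.ι z * v = u * (E.ι 1 * E.ι z * E.ι 1) * v := by rw [E.one_mul', E.mul_one']
        _ = _ := by simp only [mul_assoc]
    rw [key, WithOne.coe_inj] at h1 h2
    rw [h1, h2]
    exact σ.mul (σ.mul (σ.refl k) (σ.trans hx (σ.symm hy))) (σ.refl l)
  · exact σ.refl f

/-- With `e` the identity of `S_q` and `f = u e v`, multipliers `p`, `w` cancelling `u`, `v` give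
coordinates on the `ℋ`-class of `f`: the element `h` corresponds to `e p h w e`, a group element,
and `f` corresponds to `e`. Hence the group element is `σ`-related to `e`. -/
theorem SymIdentification.nu_conSubgroup {X : Type*} [Finite X] [Nonempty X] {r : ℕ}
    {A : IdempotentMap X r} {q : ℕ} (E : A.SymIdentification q) {σ : Con A.P} {f h c d : A.P}
    (hf : f.rank = q) (hh : h.rank = q) (hc : h = f * c) (hd : h = d * f) (hσ : σ f h) :
    E.nu (E.conSubgroup σ) f h := by
  obtain ⟨u, v, huv⟩ := exists_eq_mul_mul A.idem (f := E.ι 1) (h := f) (by rw [hf, E.rank_one])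
  have huv' : (f : WithOne A.P) = u * E.ι 1 * v := by
    rw [huv, WithOne.coe_mul, WithOne.coe_mul]
  have hee : (E.ι 1 : A.P) * E.ι 1 = E.ι 1 := by rw [← map_mul, one_mul]
  obtain ⟨p, hp⟩ := stable_left (e := E.ι 1) (g := u * E.ι 1) (WithOne.coe_mul _ _) (by
    rw [E.rank_one]
    refine hf.ge.trans ?_
    rw [huv]
    exact rank_mul_le_left _ _)
  obtain ⟨w, hw⟩ := stable_right (e := E.ι 1) (g := E.ι 1 * v) (WithOne.coe_mul _ _) (by
    rw [E.rank_one]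
    refine hf.ge.trans ?_
    rw [huv, mul_assoc]
    exact rank_mul_le_right _ _)
  -- These multipliers are one-sided identities for `f`, hence also for `h`, a left and right
  -- multiple of `f`.
  have h1 : u * E.ι 1 * p * f = f := by
    calc u * E.ι 1 * p * f = u * E.ι 1 * (p * (u * E.ι 1)) * v := by
          rw [huv]; simp only [mul_assoc]
      _ = f := by rw [hp, mul_assoc u, hee, huv]
  have h2 : f * (w * E.ι 1 * v) = f := by
    calc f * (w * E.ι 1 * v) = u * (E.ι 1 * v * w) * (E.ι 1 * v) := by
          rw [huv]; simp only [mul_assoc]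
      _ = u * (E.ι 1 * E.ι 1) * v := by rw [hw]; simp only [mul_assoc]
      _ = f := by rw [hee, huv]
  set x : A.P := E.ι 1 * (p * h * w) * E.ι 1 with hx
  have h3 : h = u * x * v := by
    calc h = d * (f * (w * E.ι 1 * v)) := by rw [h2, hd]
      _ = h * (w * E.ι 1 * v) := by rw [← mul_assoc, ← hd]
      _ = (u * E.ι 1 * p * f) * c * (w * E.ι 1 * v) := by rw [h1, hc]
      _ = u * E.ι 1 * p * h * (w * E.ι 1 * v) := by rw [mul_assoc _ f, ← hc]
      _ = _ := by rw [hx]; simp only [mul_assoc]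
  have h4 : (x : WithOne A.P) = E.ι 1 * ((p * h * w : A.P) : WithOne A.P) * E.ι 1 := by
    rw [hx, WithOne.coe_mul, WithOne.coe_mul]
  obtain ⟨c', hc'⟩ := stable_right (e := f) (g := h) (u := c) (by rw [hc, WithOne.coe_mul])
    (by rw [hf, hh])
  have h5 : p * u * x * (v * c' * w) = E.ι 1 := by
    calc p * u * x * (v * c' * w) = p * ((u * x * v) * c') * w := by simp only [mul_assoc]
      _ = p * (u * E.ι 1) * (v * w) := by rw [← h3, hc', huv]; simp only [mul_assoc]
      _ = E.ι 1 := by rw [hp, ← mul_assoc, hw]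
  obtain ⟨z, hz⟩ := E.mem_of_rank h4 ⟨((p * u : A.P) : WithOne A.P),
    ((v * c' * w : A.P) : WithOne A.P), by rw [← WithOne.coe_mul, ← WithOne.coe_mul, h5]⟩
  rw [WithOne.coe_inj] at hz
  refine ⟨hf, hh, u, v, 1, z, Subgroup.one_mem _, ?_, huv', ?_⟩
  · change σ (E.ι z) (E.ι 1)
    have h6 : E.ι 1 * (p * f * w) * E.ι 1 = E.ι 1 := by
      calc E.ι 1 * (p * f * w) * E.ι 1
          = E.ι 1 * (p * (u * E.ι 1)) * (v * w) * E.ι 1 := by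
            rw [huv]; simp only [mul_assoc]
        _ = E.ι 1 * v * w * E.ι 1 := by rw [hp, hee]; simp only [mul_assoc]
        _ = _ := by rw [hw, hee]
    have h7 := σ.mul (σ.mul (σ.refl (E.ι 1)) (σ.mul (σ.mul (σ.refl p) (σ.symm hσ)) (σ.refl w)))
      (σ.refl (E.ι 1))
    rwa [h6, ← hx, hz] at h7
  · rw [← hz, ← WithOne.coe_mul, ← WithOne.coe_mul, ← h3]

/-! ### Existence -/

theorem rank_le {X : Type*} {r : ℕ} (A : IdempotentMap X r) [Finite X] (f : A.P) :
    f.rank ≤ r := by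
  refine f.rank_le_ncard_range.trans ?_
  rw [← A.range_pt, ← Set.image_univ, Set.ncard_image_of_injective _ A.pt_injective,
    Set.ncard_univ, Nat.card_eq_fintype_card, Fintype.card_fin]

/-- Rank `0` is collapsed vacuously, since images are nonempty, and rank `r` is not, since that
would make `σ` universal. So the first failure occurs at a successor. -/
theorem exists_max_collapses {X : Type*} [Finite X] [Nonempty X] {r : ℕ} (A : IdempotentMap X r)
    {σ : Con A.P} (hσ : σ ≠ ⊤) :
    ∃ q, q + 1 ≤ r ∧ Collapses σ q ∧ ¬ Collapses σ (q + 1) := by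
  classical
  have hr : ¬ Collapses σ r := fun h => hσ <| by
    ext f g
    exact ⟨fun _ => trivial, fun _ => h f g (A.rank_le f) (A.rank_le g)⟩
  have h : ∃ q, ¬ Collapses σ q := ⟨r, hr⟩
  have h0 : Collapses σ 0 := fun f g hf _ => absurd f.rank_pos (by omega)
  obtain ⟨q, hq⟩ : ∃ q, Nat.find h = q + 1 :=
    Nat.exists_eq_succ_of_ne_zero fun h' => (h' ▸ Nat.find_spec h) h0
  exact ⟨q, hq ▸ Nat.find_le hr, not_not.1 (Nat.find_min h (by omega)), hq ▸ Nat.find_spec h⟩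

/-- The decomposition of a congruence that collapses exactly the elements of rank at most `k`. -/
theorem le_sup_of_collapses {X : Type*} [Finite X] [Nonempty X] {r : ℕ} {A : IdempotentMap X r}
    {σ : Con A.P} {k : ℕ} (E : A.SymIdentification (k + 1)) (hc : Collapses σ k)
    (hc' : ¬ Collapses σ (k + 1)) :
    σ ≤ E.RCon (E.conSubgroup σ) (E.conSubgroup_normal σ) ⊔ (PSystem.ofCon σ).lamCon ⊔
      (CSystem.ofCon σ).rhoCon := by
  set τ := E.RCon (E.conSubgroup σ) (E.conSubgroup_normal σ) ⊔ (PSystem.ofCon σ).lamCon ⊔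
      (CSystem.ofCon σ).rhoCon with hτ
  have hR : E.RCon (E.conSubgroup σ) (E.conSubgroup_normal σ) ≤ τ :=
    le_sup_left.trans le_sup_left
  have hkappa : ∀ f g, σ f g → kappa f g → τ f g := by
    intro f g h hk
    -- Both halves of the splitting lie in `σ`, so one belongs to `ρ(Ψ₂)` and the other to `λ(Ψ₁)`.
    obtain ⟨t, h1, h2, h3⟩ := exists_rho_lam hk
    have h4 := h3 σ h
    have h5 : τ f t := (le_sup_right : (CSystem.ofCon σ).rhoCon ≤ τ)
      ((CSystem.rhoRel_ofCon σ f t).2 ⟨h1, h4⟩)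
    have h6 : τ t g := (le_sup_right.trans le_sup_left : (PSystem.ofCon σ).lamCon ≤ τ)
      ((PSystem.lamRel_ofCon σ t g).2 ⟨h2, σ.trans (σ.symm h4) h⟩)
    exact τ.trans h5 h6
  have key : ∀ f g, g.rank ≤ f.rank → σ f g → τ f g := by
    intro f g hr h
    rcases Nat.lt_or_ge k f.rank with hf | hf
    · rcases collapses_succ_or A.idem hc h hf hr with h1 | h1 | ⟨h1, h2, h3, h4⟩
      · exact absurd h1 hc'
      · exact hkappa f g h h1
      · obtain ⟨t, h5, h6, ⟨c, h7⟩, ⟨d, h8⟩⟩ := exists_greenH_kappa h h3 h4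
        have h9 : τ f t := hR (Or.inr (Or.inl (E.nu_conSubgroup h1
          ((rank_eq_of_kappa h6).trans h2) h7 h8 h5)))
        exact τ.trans h9 (hkappa t g (σ.trans (σ.symm h5) h) h6)
    · exact hR (Or.inl ⟨by omega, by omega⟩)
  intro f g h
  rcases le_total g.rank f.rank with hr | hr
  · exact key f g hr h
  · exact τ.symm (key g f hr (σ.symm h))

/-! ### Uniqueness -/

theorem DecompositionData.PRel_eq_top {X : Type*} {r : ℕ} {A : IdempotentMap X r}
    (d : A.DecompositionData) {I : Setoid (Fin r)} (hI : Nat.card (Quotient I) < d.q) :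
    d.Ψ₁.rel I = ⊤ :=
  (d.Ψ₁.le_rank_iff ((Nat.sub_le _ _).trans d.q_le)).1 d.rank_Ψ₁ I (by omega)

theorem DecompositionData.CRel_eq_top {X : Type*} {r : ℕ} {A : IdempotentMap X r}
    (d : A.DecompositionData) {I : Finset (Fin r)} (hI : I.Nonempty) (hc : I.card < d.q) :
    d.Ψ₂.rel I hI = ⊤ :=
  (d.Ψ₂.le_rank_iff ((Nat.sub_le _ _).trans d.q_le)).1 d.rank_Ψ₂ I hI (by omega)

/-- The congruence given by the decomposition data `d`. -/
noncomputable def DecompositionData.con {X : Type*} [Finite X] [Nonempty X] {r : ℕ}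
    {A : IdempotentMap X r} (E : ∀ q : ℕ, 1 ≤ q → q ≤ r → A.SymIdentification q)
    (d : A.DecompositionData) : Con A.P :=
  (E d.q d.one_le_q d.q_le).RCon d.N d.normal ⊔ d.Ψ₁.lamCon ⊔ d.Ψ₂.rhoCon

section

variable {X : Type*} [Finite X] [Nonempty X] {r : ℕ} {A : IdempotentMap X r}
  (E : ∀ q : ℕ, 1 ≤ q → q ≤ r → A.SymIdentification q) (d : A.DecompositionData)

theorem DecompositionData.con_iff (f g : A.P) : d.con E f g ↔ ∃ h k,
    (E d.q d.one_le_q d.q_le).RRel d.N f h ∧ d.Ψ₁.lamRel h k ∧ d.Ψ₂.rhoRel k g :=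
  (E d.q d.one_le_q d.q_le).sup_iff d.normal d.Ψ₁ d.Ψ₂ f g

theorem DecompositionData.con_of_RRel {f g : A.P}
    (h : (E d.q d.one_le_q d.q_le).RRel d.N f g) : d.con E f g :=
  (le_sup_left.trans le_sup_left :
    (E d.q d.one_le_q d.q_le).RCon d.N d.normal ≤ d.con E) h

theorem DecompositionData.con_of_lamRel {f g : A.P} (h : d.Ψ₁.lamRel f g) : d.con E f g :=
  (le_sup_right.trans le_sup_left : d.Ψ₁.lamCon ≤ d.con E) h

theorem DecompositionData.con_of_rhoRel {f g : A.P} (h : d.Ψ₂.rhoRel f g) : d.con E f g :=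
  (le_sup_right : d.Ψ₂.rhoCon ≤ d.con E) h

/-- For fewer than `q` blocks both sides are universal, by the rank condition. For at least `q`
blocks the representatives have rank at least `q`, where the `λ`-factor of the composite can be
isolated. -/
theorem DecompositionData.Ψ₁_eq : d.Ψ₁ = PSystem.ofCon (d.con E) := by
  apply PSystem.ext
  funext I
  ext S S'
  change _ ↔ d.con E S.proj S'.proj
  constructor
  · intro h
    exact d.con_of_lamRel E ((d.Ψ₁.rel_iff S S').1 h)
  · intro h
    rcases Nat.lt_or_ge (Nat.card (Quotient I)) d.q with hI | hI
    · rw [d.PRel_eq_top hI]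
      trivial
    · obtain ⟨h', k, h1, h2, h3⟩ := (d.con_iff E _ _).1 h
      exact (d.Ψ₁.rel_iff S S').2
        (lamRel_of_comp h1 h2 h3 (by rwa [S.rank_proj]) (S.lam_proj S'))

theorem DecompositionData.Ψ₂_eq : d.Ψ₂ = CSystem.ofCon (d.con E) := by
  apply CSystem.ext
  funext I hI
  ext C C'
  change _ ↔ d.con E (C.sect hI) (C'.sect hI)
  constructor
  · intro h
    exact d.con_of_rhoRel E ((d.Ψ₂.rel_iff hI C C').1 h)
  · intro h
    rcases Nat.lt_or_ge I.card d.q with hc | hc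
    · rw [d.CRel_eq_top hI hc]
      trivial
    · obtain ⟨h', k, h1, h2, h3⟩ := (d.con_iff E _ _).1 h
      exact (d.Ψ₂.rel_iff hI C C').2
        (rhoRel_of_comp h1 h2 h3 (by rwa [C.rank_sect]) (C.rho_sect C' hI))

theorem DecompositionData.N_eq :
    d.N = (E d.q d.one_le_q d.q_le).conSubgroup (d.con E) := by
  ext x
  rw [← (E d.q d.one_le_q d.q_le).RRel_iff_mem d.normal]
  change _ ↔ d.con E _ _
  constructor
  · exact d.con_of_RRel E
  · intro h
    obtain ⟨h', k, h1, h2, h3⟩ := (d.con_iff E _ _).1 h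
    obtain ⟨h4, h5⟩ := ((E d.q d.one_le_q d.q_le).mem_range_iff _).1 ⟨x, rfl⟩
    exact RRel_of_comp h1 h2 h3 (SymIdentification.rank_eq _ _).ge (greenL_iff.1 h4)
      (greenR_iff.1 h5)

/-- There are two elements of rank at most `q < r`, the first of rank `q`, whose images are different
modulo `a`. -/
theorem exists_im_ne {q : ℕ} (h1 : 1 ≤ q) (hq : q < r) : ∃ f g : A.P, f.rank = q ∧ g.rank ≤ q ∧
    A.a '' f.im ≠ A.a '' g.im := by
  classical
  obtain ⟨e⟩ := A.nonempty_symIdentification q h1 hq.le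
  set f : A.P := e.ι 1
  have hf : f.rank = q := e.rank_one
  obtain ⟨i, hi⟩ : ∃ i, A.pt i ∉ A.a '' f.im := by
    by_contra! h
    have h2 : (Set.range A.pt).ncard ≤ (A.a '' f.im).ncard :=
      Set.ncard_le_ncard (by rintro _ ⟨i, rfl⟩; exact h i) (Set.toFinite _)
    rw [← im_bar, ← rank_eq_ncard_bar, hf, ← Set.image_univ,
      Set.ncard_image_of_injective _ A.pt_injective, Set.ncard_univ, Nat.card_eq_fintype_card,
      Fintype.card_fin] at h2
    omega
  refine ⟨f, f * RegVariant.const A.a (A.pt i), hf, hf ▸ rank_mul_le_left _ _, fun h => hi ?_⟩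
  rw [h]
  obtain ⟨x⟩ := ‹Nonempty X›
  exact ⟨A.pt i, ⟨x, rfl⟩, A.a_pt i⟩

/-- The congruence of `d` preserves the image modulo `a` of every element of rank at least `d.q`,
whereas a larger `d'.q` would collapse two elements of rank at most `d.q` with different images
modulo `a`. -/
theorem DecompositionData.q_le_of_con_eq {d' : A.DecompositionData} (h : d.con E = d'.con E) :
    d'.q ≤ d.q := by
  by_contra! hlt
  obtain ⟨f, g, hf, hg, hne⟩ := exists_im_ne (A := A) d.one_le_q (hlt.trans_le d'.q_le)
  have h1 : d.con E f g := by
    rw [h]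
    exact d'.con_of_RRel E (Or.inl ⟨by omega, by omega⟩)
  obtain ⟨h', k, h1, h2, h3⟩ := (d.con_iff E _ _).1 h1
  apply hne
  rw [((E d.q d.one_le_q d.q_le).RRel_greenH h1 hf.ge).1, ← im_bar, ← im_bar,
    (PSystem.lam_of_lamRel h2).1, (CSystem.rho_of_rhoRel h3).1]

theorem DecompositionData.eq_of_con_eq {d d' : A.DecompositionData}
    (h : d.con E = d'.con E) : d = d' := by
  have hq : d.q = d'.q :=
    le_antisymm (d'.q_le_of_con_eq E h.symm) (d.q_le_of_con_eq E h)
  have hP := d.Ψ₁_eq E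
  have hC := d.Ψ₂_eq E
  have hN := d.N_eq E
  rw [h] at hP hC hN
  rw [← d'.Ψ₁_eq E] at hP
  rw [← d'.Ψ₂_eq E] at hC
  have hN' := d'.N_eq E
  generalize d'.con E = σ at hN hN'
  clear h
  obtain ⟨q, h1, h2, N, hn, Ψ₁, Ψ₂, h3, h4⟩ := d
  obtain ⟨q', h1', h2', N', hn', Ψ₁', Ψ₂', h3', h4'⟩ := d'
  dsimp only at hq hP hC hN hN'
  subst hq hP hC
  obtain rfl := hN.trans hN'.symm
  rfl

end

end IdempotentMap

/-! ### The decomposition theorem. -/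

theorem theorem8p1 {X : Type*} [Finite X] [Nonempty X] {r : ℕ} (A : IdempotentMap X r)
    (E : ∀ q : ℕ, 1 ≤ q → q ≤ r → A.SymIdentification q) (σ : Con A.P) (hσ : σ ≠ ⊤) :
    ∃ d : A.DecompositionData,
      (σ = (E d.q d.one_le_q d.q_le).RCon d.N d.normal ⊔ d.Ψ₁.lamCon ⊔ d.Ψ₂.rhoCon ∧
        ∀ f g : A.P, σ f g ↔ Relation.Comp (Relation.Comp
          ((E d.q d.one_le_q d.q_le).RCon d.N d.normal) d.Ψ₁.lamCon) d.Ψ₂.rhoCon f g) ∧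
      ∀ d' : A.DecompositionData,
        σ = (E d'.q d'.one_le_q d'.q_le).RCon d'.N d'.normal ⊔ d'.Ψ₁.lamCon ⊔ d'.Ψ₂.rhoCon →
          d' = d := by
  obtain ⟨k, hk, hc, hc'⟩ := A.exists_max_collapses hσ
  let e := E (k + 1) (Nat.le_add_left 1 k) hk
  -- Everything is read off `σ`: `q` is the first rank not collapsed. The rank conditions hold
  -- because representatives for at most `k` blocks or indices have rank at most `k` and are
  -- therefore identified by `σ`.
  let d : A.DecompositionData :=
    { q := k + 1
      one_le_q := Nat.le_add_left 1 k
      q_le := hk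
      N := e.conSubgroup σ
      normal := e.conSubgroup_normal σ
      Ψ₁ := .ofCon σ
      Ψ₂ := .ofCon σ
      rank_Ψ₁ := by
        rw [IdempotentMap.PSystem.le_rank_iff _ (by omega)]
        intro I hI
        ext S S'
        refine ⟨fun _ => trivial, fun _ => hc _ _ ?_ ?_⟩ <;>
          rw [IdempotentMap.PartitionOver.rank_proj] <;> exact hI
      rank_Ψ₂ := by
        rw [IdempotentMap.CSystem.le_rank_iff _ (by omega)]
        intro I hI hcard
        ext C C'
        refine ⟨fun _ => trivial, fun _ => hc _ _ ?_ ?_⟩ <;>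
          rw [IdempotentMap.CrossSection.rank_sect] <;> exact hcard }
  have hd : σ = d.con E := by
    refine le_antisymm (IdempotentMap.le_sup_of_collapses e hc hc')
      (sup_le (sup_le ?_ ?_) ?_)
    · intro f g h
      exact e.RCon_conSubgroup_le (fun f g hf hg => hc f g (by omega) (by omega)) h
    · intro f g h
      exact ((IdempotentMap.PSystem.lamRel_ofCon σ f g).1 h).2
    · intro f g h
      exact ((IdempotentMap.CSystem.rhoRel_ofCon σ f g).1 h).2
  refine ⟨d, ⟨hd, fun f g => ?_⟩, fun d' h => ?_⟩
  · constructor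
    · intro h
      rw [hd] at h
      obtain ⟨t, s, h1, h2, h3⟩ := (d.con_iff E f g).1 h
      exact ⟨s, ⟨t, h1, h2⟩, h3⟩
    · rintro ⟨s, ⟨t, h1, h2⟩, h3⟩
      rw [hd]
      exact (d.con_iff E f g).2 ⟨t, s, h1, h2, h3⟩
  · exact IdempotentMap.DecompositionData.eq_of_con_eq E (h.symm.trans hd)
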